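/- Let $T\ge 1$ and $D$ be integers, let $Y=(Y_1,\dots,Y_T)$ be a stochastic process with values in $\mathbb{R}^D$ (not necessarily Markovian), write $Y_{[t]}=(Y_1,\dots,Y_t)$, and let $g_t:\mathbb{R}^{D\times t}\to\mathbb{R}$ $(1\le t\le T)$ be measurable payout functions. Put $Z_t=g_t(Y_{[t]})$ and $\mathrm{OPT}=\inf_\tau \mathbb{E}[Z_\tau]$, where $\tau$ ranges over the stopping times of the natural filtration of $Y$ with values in $\{1,\dots,T\}$. A base simulator $\mathcal{B}$ takes as input $t\in\{0,\dots,T\}$ and $\gamma\in\mathbb{R}^{D\times t}$ and returns a sample, independent of all earlier ones, from the regular conditional distribution of $Y$ given $Y_{[t]}=\gamma$ (from the distribution of $Y$ if $t=0$). A call to $\mathcal{B}$ takes $C\ge 1$ units of time, an evaluation of $g_t(\gamma)$ takes $G\ge 1$ units, and the addition, subtraction, multiplication, division, maximum, minimum or comparison of two real numbers takes one unit; reading, writing and storing data and passing arguments are free. There is a randomized algorithm $\mathcal{A}$ (one finite program with rational constants, the same for all problems), whose input is $T$ and $\epsilon,\delta\in(0,1)$, and whose only access to $Y$, to the $g_t$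 and to randomness is by evaluating the $g_t$ and by calling $\mathcal{B}$, with the following property. Whenever almost surely $Z_t\in[0,1]$ for all $t\in\{1,\dots,T\}$, then for all $\epsilon,\delta\in(0,1)$, almost surely $\mathcal{A}$ terminates in total computational time at most $$(C+G+1)\,\exp(200\,\epsilon^{-2})\;T^{6\epsilon^{-1}}\Bigl(1+\log\tfrac1\delta\Bigr)^{6\epsilon^{-1}}$$ and makes at most $$\exp(200\,\epsilon^{-2})\;T^{6\epsilon^{-1}}\Bigl(1+\log\tfrac1\delta\Bigr)^{6\epsilon^{-1}}$$ calls to $\mathcal{B}$, and it returns a random number $X$ with $\mathbb{P}\bigl(|X-\mathrm{OPT}|\le\epsilon\bigr)\ge 1-\delta$. -/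

import Mathlib

open MeasureTheory ProbabilityTheory

namespace OptStop

/-! ### The optimal stopping problem -/

/-- A history of length `n`: the first `n` columns of a matrix with `D` rows. -/
abbrev Hist (D n : ℕ) : Type := Fin n → Fin D → ℝ

/-- A full sample path, a `D` by `T` matrix given by its columns; the column with index `i : Fin T`
belongs to time `i + 1`. -/
abbrev SamplePath (T D : ℕ) : Type := Hist D T

/-- The first `n` columns of a sample path. -/
def SamplePath.take {T D : ℕ} (n : ℕ) (h : n ≤ T) (y : SamplePath T D) : Hist D n :=
  fun i => y (Fin.castLE h i)

/-- Payout functions: one function of the history of length `t` for every time `t = 1, …, T`. -/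
abbrev Payouts (T D : ℕ) : Type := (i : Fin T) → Hist D (i + 1) → ℝ

/-- The payout, along a path, of stopping at time `i + 1`. -/
def payout {T D : ℕ} (g : Payouts T D) (i : Fin T) (y : SamplePath T D) : ℝ :=
  g i (y.take (i + 1) i.isLt)

/-- The natural filtration of the process `Y`. -/
noncomputable def pathFiltration {T D : ℕ} {Ω : Type*} [mΩ : MeasurableSpace Ω]
    (Y : Ω → SamplePath T D) (hY : Measurable Y) : Filtration (Fin T) mΩ :=
  Filtration.natural (fun i ω => Y ω i)
    (fun i => ((measurable_pi_apply i).comp hY).stronglyMeasurable)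

/-- The optimal value: the infimum of the expected payout over all stopping times of the natural
filtration. -/
noncomputable def optValue {T D : ℕ} {Ω : Type*} [MeasurableSpace Ω] (P : Measure Ω)
    (Y : Ω → SamplePath T D) (hY : Measurable Y) (g : Payouts T D) : ℝ :=
  ⨅ τ : {τ : Ω → Fin T // IsStoppingTime (pathFiltration Y hY) (fun ω => (τ ω : WithTop (Fin T)))},
    ∫ ω, payout g (τ.1 ω) (Y ω) ∂P

/-- A base simulator: for every `t = 0, …, T`, a map that sends a history of length `t` to the
probability distribution of the path it returns. -/
abbrev Simulator (T D : ℕ) : Type := (t : Fin (T + 1)) → Kernel (Hist D t) (SamplePath T D)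

/-- The base simulator is correct for `Y`: on input a history of length `t` it samples from (a
version of) the regular conditional distribution of `Y` given its first `t` columns. For `t = 0` this
is the distribution of `Y`. -/
def IsBaseSimulator {T D : ℕ} {Ω : Type*} [MeasurableSpace Ω] (P : Measure Ω)
    (Y : Ω → SamplePath T D) (B : Simulator T D) : Prop :=
  ∀ t : Fin (T + 1),
    HasCondDistrib Y (fun ω => (Y ω).take t (Nat.le_of_lt_succ t.isLt)) (B t) P

/-! ### Randomized algorithms

Programs are finite pieces of code over number registers and path registers, with recursive procedure
calls. Their only access to the payouts and to randomness is by the instructions `eval` and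
`sample`. -/

/-- The arithmetic operations. -/
inductive ArithOp
  | add | sub | mul | div | max | min

/-- The value of an arithmetic operation. -/
noncomputable def ArithOp.apply : ArithOp → ℝ → ℝ → ℝ
  | .add, x, y => x + y
  | .sub, x, y => x - y
  | .mul, x, y => x * y
  | .div, x, y => x / y
  | .max, x, y => Max.max x y
  | .min, x, y => Min.min x y

/-- Code of one procedure. Registers are named by natural numbers, and `next` is the code that is
executed afterwards. -/
inductive Code
  /-- return the content of number register `i` -/
  | ret (i : ℕ)
  /-- write the rational constant `q` into number register `dst` -/
  | lit (dst : ℕ) (q : ℚ) (next : Code)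
  /-- apply an arithmetic operation to number registers `i`, `j`, and write the result into `dst` -/
  | arith (op : ArithOp) (dst i j : ℕ) (next : Code)
  /-- continue with `yes` if the content of number register `i` is at most that of `j`, with `no`
  otherwise -/
  | branch (i j : ℕ) (yes no : Code)
  /-- write into number register `dst` the payout at time `t` along path register `p`, where `t` is the
  content of number register `i` -/
  | eval (dst i p : ℕ) (next : Code)
  /-- call the base simulator on the first `t` columns of path register `p`, where `t` is the content
  of number register `i`, and write the path obtained into path register `dst` -/
  | sample (dst i p : ℕ) (next : Code)
  /-- call procedure `f`, passing the contents of the number registers `xs` and of the path registers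
  `ps`, and write the number it returns into number register `dst` -/
  | call (dst f : ℕ) (xs ps : List ℕ) (next : Code)

/-- A program is a finite list of procedures, the first of which is the main one. -/
abbrev Program : Type := List Code

/-- Resources used: calls to the base simulator, payout evaluations, and elementary operations
(arithmetic operations and comparisons). -/
structure Usage where
  calls : ℕ
  evals : ℕ
  ops : ℕ

instance : MeasurableSpace Usage := ⊤

/-- Computational time, if a call to the simulator takes time `C`, a payout evaluation takes time `G`,
and an elementary operation takes time `1`. -/
def Usage.time (C G : ℝ) (u : Usage) : ℝ := C * u.calls + G * u.evals + u.ops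

/-- The registers of the running procedure: numbers and paths. -/
abbrev Frame (T D : ℕ) : Type := (ℕ → ℝ) × (ℕ → SamplePath T D)

/-- The result of a run: the number returned and the resources used so far. -/
abbrev Outcome : Type := ℝ × Usage

/-- The payout at time `n` along `y` (zero unless `1 ≤ n ≤ T`). -/
def evalPayout {T D : ℕ} (g : Payouts T D) (n : ℕ) (y : SamplePath T D) : ℝ :=
  if h : 0 < n ∧ n ≤ T then payout g ⟨n - 1, by omega⟩ y else 0

/-- The distribution of the answer of the simulator to the first `n` columns of `y` (all columns if
`n > T`). -/
noncomputable def simulate {T D : ℕ} (B : Simulator T D) (n : ℕ) (y : SamplePath T D) :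
    Measure (SamplePath T D) :=
  B ⟨min n T, by omega⟩ (y.take (min n T) (Nat.min_le_right n T))

/-- The frame in which a called procedure starts: its registers `0, 1, …` hold the arguments, the
remaining ones hold zero. -/
def Frame.pass {T D : ℕ} (s : Frame T D) (xs ps : List ℕ) : Frame T D :=
  (fun n => (xs[n]?).elim 0 s.1, fun n => (ps[n]?).elim 0 s.2)

/-- The distribution of the outcome of executing code in a given frame, with resources `u` already
used, if `callee f` describes the runs of procedure `f`. -/
noncomputable def exec {T D : ℕ} (g : Payouts T D) (B : Simulator T D)
    (callee : ℕ → Frame T D → Usage → Measure Outcome) :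
    Code → Frame T D → Usage → Measure Outcome
  | .ret i, s, u => Measure.dirac (s.1 i, u)
  | .lit dst q next, s, u =>
      exec g B callee next (Function.update s.1 dst (q : ℝ), s.2) u
  | .arith op dst i j next, s, u =>
      exec g B callee next (Function.update s.1 dst (op.apply (s.1 i) (s.1 j)), s.2)
        { u with ops := u.ops + 1 }
  | .branch i j yes no, s, u =>
      if s.1 i ≤ s.1 j then exec g B callee yes s { u with ops := u.ops + 1 }
      else exec g B callee no s { u with ops := u.ops + 1 }
  | .eval dst i p next, s, u =>
      exec g B callee next
        (Function.update s.1 dst (evalPayout g ⌊s.1 i⌋₊ (s.2 p)), s.2)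
        { u with evals := u.evals + 1 }
  | .sample dst i p next, s, u =>
      (simulate B ⌊s.1 i⌋₊ (s.2 p)).bind fun y =>
        exec g B callee next (s.1, Function.update s.2 dst y) { u with calls := u.calls + 1 }
  | .call dst f xs ps next, s, u =>
      (callee f (s.pass xs ps) u).bind fun o =>
        exec g B callee next (Function.update s.1 dst o.1, s.2) o.2

/-- The distribution of the outcome of procedure `f` of a program, restricted to the event that the
nesting depth of procedure calls is less than `depth`. Its total mass is the probability of that
event, so it is a probability measure exactly if the run almost surely ends within this depth. -/
noncomputable def run {T D : ℕ} (A : Program) (g : Payouts T D) (B : Simulator T D) :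
    (depth : ℕ) → (f : ℕ) → Frame T D → Usage → Measure Outcome
  | 0 => fun _ _ _ => 0
  | depth + 1 => fun f => exec g B (run A g B depth) (A.getD f (.ret 0))

/-- The distribution of the outcome of a program on input `ε`, `δ`, `T`, which it finds in its number
registers `0`, `1`, `2`, restricted to the event that procedure calls are nested less than `depth`
deep. -/
noncomputable def runOn {T D : ℕ} (A : Program) (g : Payouts T D) (B : Simulator T D)
    (ε δ : ℝ) (depth : ℕ) : Measure Outcome :=
  run A g B depth 0 (fun n => [ε, δ, (T : ℝ)].getD n 0, 0) ⟨0, 0, 0⟩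

/-- The bound on the number of calls to the simulator. -/
noncomputable def callBound (T : ℕ) (ε δ : ℝ) : ℝ :=
  Real.exp (200 * (ε ^ 2)⁻¹) * (T : ℝ) ^ (6 / ε) * (1 + Real.log (1 / δ)) ^ (6 / ε)

end OptStop

/-! Put Z^0 = Z and Z^{k+1}_t = Z^k_t - E[M^k | Y_[t]], where M^k is the minimum of Z^k over the
times 1, …, T. Each step subtracts a martingale, so E[Z^k_τ] = E[Z_τ] - Σ_{j<k} E[M^j] for every
stopping time τ (`integral_stopped_value`). Conditioning M^k ≤ Z^k_t on the past gives Z^{k+1} ≥ 0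
(`ae_value_nonneg`), whence OPT ≥ Σ_{j<k} E[M^j]. At t = T the conditioning is trivial, so 0 ≤
Z^{k+1}_T = Z_T - Σ_{j≤k} M^j; as Z_T ≤ 1 and the M^j decrease in j, M^k ≤ 1/(k+1)
(`ae_clippedMin_le`). Stopping once Z^k ≤ 1/(k+1) shows that the lower bound is off by at most
1/(k+1) (`optValue_bounds`).

The payout at time 0 is zero by default, so the level-K value function at time 0 is exactly -Σ_{j<K}
E[M^j] (`value_zero`). The algorithm estimates it by nested Monte Carlo. If level k has error e,
level k+1 has error 2e + r (`estLaw_accuracy`). Minima are clipped to [0,1], so failing inner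
estimates only add bias; no union bound over the N samples is needed, and failure probabilities grow
linearly in k. With K about 2/ε and N of order 64^K T (1 + log(1/δ)) the total error is at most ε.
The recursion has depth K and branching of order NT, which gives the cost.

Branches of the program depend on ε, δ and counters, never on sampled data. Hence resource usage is
deterministic, and a run is the law of a number paired with a constant (`Yields`). The procedures
realize `minLaw`, `sumLaw` and `estLaw`; the probabilistic analysis concerns these laws only. -/

namespace OptStop

open scoped ENNReal NNReal

/-! ### Families of subprobability measures -/

section Families

variable {α β γ : Type*} [MeasurableSpace α] [MeasurableSpace β] [MeasurableSpace γ]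

/-- A measurable family of measures of total mass at most one. -/
structure IsSubProb (κ : α → Measure β) : Prop where
  measurable : Measurable κ
  le_one : ∀ a, κ a Set.univ ≤ 1

theorem IsSubProb.of_isProbabilityMeasure {κ : α → Measure β} (hκ : Measurable κ)
    (h : ∀ a, IsProbabilityMeasure (κ a)) : IsSubProb κ :=
  ⟨hκ, fun a => (h a).measure_univ.le⟩

theorem IsSubProb.comp {κ : β → Measure γ} (hκ : IsSubProb κ) {f : α → β} (hf : Measurable f) :
    IsSubProb (fun a => κ (f a)) :=
  ⟨hκ.measurable.comp hf, fun _ => hκ.le_one _⟩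

/-- The mass bound turns the first family into a finite kernel, for which integrals of jointly
measurable functions are measurable in the parameter. -/
theorem IsSubProb.bind {κ : α → Measure β} {η : α × β → Measure γ} (hκ : IsSubProb κ)
    (hη : IsSubProb η) : IsSubProb (fun a => (κ a).bind fun b => η (a, b)) := by
  have hη' : ∀ a, Measurable fun b => η (a, b) := fun a => hη.measurable.comp (by fun_prop)
  refine ⟨?_, fun a => ?_⟩
  · let K : Kernel α β := ⟨κ, hκ.measurable⟩
    have : IsFiniteKernel K := ⟨1, ENNReal.one_lt_top, hκ.le_one⟩
    refine Measure.measurable_of_measurable_coe _ fun s hs => ?_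
    have h2 : Measurable fun p : α × β => η p s := (Measure.measurable_coe hs).comp hη.measurable
    have h3 := Measurable.lintegral_kernel_prod_right' (κ := K) h2
    have h4 : (fun a => ((κ a).bind fun b => η (a, b)) s) = fun a => ∫⁻ b, η (a, b) s ∂K a := by
      ext a
      rw [Measure.bind_apply hs (hη' a).aemeasurable]
      rfl
    rw [h4]
    exact h3
  · rw [Measure.bind_apply MeasurableSet.univ (hη' a).aemeasurable]
    calc ∫⁻ b, η (a, b) Set.univ ∂κ a ≤ ∫⁻ _, 1 ∂κ a := lintegral_mono fun b => hη.le_one _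
      _ ≤ 1 := by simpa using hκ.le_one a

theorem isSubProb_dirac {f : α → β} (hf : Measurable f) : IsSubProb fun a => Measure.dirac (f a) :=
  .of_isProbabilityMeasure (Measure.measurable_dirac.comp hf) fun _ => inferInstance

theorem IsSubProb.ite {κ η : α → Measure β} (hκ : IsSubProb κ) (hη : IsSubProb η) {p : α → Prop}
    [DecidablePred p] (hp : MeasurableSet {a | p a}) :
    IsSubProb fun a => if p a then κ a else η a :=
  ⟨Measurable.ite hp hκ.measurable hη.measurable, fun a => by
    split_ifs
    exacts [hκ.le_one a, hη.le_one a]⟩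

theorem bind_map_left {μ : Measure α} {f : α → β} (hf : Measurable f) {η : β → Measure γ}
    (hη : Measurable η) : (μ.map f).bind η = μ.bind fun a => η (f a) := by
  ext s hs
  rw [Measure.bind_apply hs hη.aemeasurable,
    Measure.bind_apply (f := fun a => η (f a)) hs (hη.comp hf).aemeasurable,
    lintegral_map (f := fun b => η b s) ((Measure.measurable_coe hs).comp hη) hf]

theorem bind_map_right {μ : Measure α} {η : α → Measure β} (hη : Measurable η) {f : β → γ}
    (hf : Measurable f) : (μ.bind fun a => (η a).map f) = (μ.bind η).map f := by
  have hm : Measurable fun a => (η a).map f := (Measure.measurable_map f hf).comp hη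
  ext s hs
  rw [Measure.bind_apply hs hm.aemeasurable, Measure.map_apply hf hs,
    Measure.bind_apply (hf hs) hη.aemeasurable]
  exact lintegral_congr fun a => Measure.map_apply hf hs

theorem isProbabilityMeasure_bind {μ : Measure α} [IsProbabilityMeasure μ] {η : α → Measure β}
    (hη : Measurable η) (h : ∀ a, IsProbabilityMeasure (η a)) :
    IsProbabilityMeasure (μ.bind η) := by
  refine ⟨?_⟩
  rw [Measure.bind_apply MeasurableSet.univ hη.aemeasurable]
  simp

theorem measurable_update {ι : Type*} [DecidableEq ι] {f : α → ι → β} {v : α → β}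
    (hf : Measurable f) (hv : Measurable v) (i : ι) :
    Measurable fun a => Function.update (f a) i (v a) := by
  refine measurable_pi_iff.2 fun j => ?_
  by_cases h : j = i
  · subst h
    simpa using hv
  · simpa [Function.update_of_ne h] using measurable_pi_iff.1 hf j

end Families

/-! ### Measurability of the semantics of programs -/

section Semantics

variable {T D : ℕ}

theorem measurable_take (n : ℕ) (h : n ≤ T) :
    Measurable (SamplePath.take n h : SamplePath T D → Hist D n) :=
  measurable_pi_iff.2 fun i => measurable_pi_apply (Fin.castLE h i)

theorem measurable_payout {g : Payouts T D} (hg : ∀ i, Measurable (g i)) (i : Fin T) :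
    Measurable (payout g i) :=
  (hg i).comp (measurable_take _ _)

theorem measurable_evalPayout {g : Payouts T D} (hg : ∀ i, Measurable (g i)) (n : ℕ) :
    Measurable (evalPayout g n) := by
  unfold evalPayout
  by_cases h : 0 < n ∧ n ≤ T
  · simpa [h] using measurable_payout hg _
  · simp [h]

instance isProbabilityMeasure_simulate {B : Simulator T D} [∀ t, IsMarkovKernel (B t)] (n : ℕ)
    (y : SamplePath T D) : IsProbabilityMeasure (simulate B n y) := by
  unfold simulate
  infer_instance

theorem measurable_simulate (B : Simulator T D) (n : ℕ) : Measurable (simulate B n) :=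
  (B _).measurable.comp (measurable_take _ _)

theorem measurable_arith (op : ArithOp) : Measurable fun p : ℝ × ℝ => op.apply p.1 p.2 := by
  cases op <;> simp only [ArithOp.apply] <;> fun_prop

theorem measurable_usage {α : Type*} [MeasurableSpace α] (f : Usage → α) : Measurable f :=
  measurable_from_top

/-- Measurability in frame and usage is what makes every `bind` in `exec` computable. Mass below one
has to be allowed because runs are cut off at a finite call depth. -/
theorem isSubProb_exec {g : Payouts T D} (hg : ∀ i, Measurable (g i)) {B : Simulator T D}
    [∀ t, IsMarkovKernel (B t)] {callee : ℕ → Frame T D → Usage → Measure Outcome}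
    (hcallee : ∀ f, IsSubProb fun p : Frame T D × Usage => callee f p.1 p.2) (c : Code) :
    IsSubProb fun p : Frame T D × Usage => exec g B callee c p.1 p.2 := by
  have hnum (i : ℕ) : Measurable fun p : Frame T D × Usage => p.1.1 i := by fun_prop
  have hpath (i : ℕ) : Measurable fun p : Frame T D × Usage => p.1.2 i := by fun_prop
  have husage (f : Usage → Usage) : Measurable fun p : Frame T D × Usage => f p.2 :=
    (measurable_usage f).comp measurable_snd
  induction c with simp only [exec]
  | ret i => exact isSubProb_dirac ((hnum i).prodMk measurable_snd)
  | lit dst q next ih =>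
    exact ih.comp (((measurable_update (by fun_prop) measurable_const dst).prodMk
      (by fun_prop)).prodMk measurable_snd)
  | arith op dst i j next ih =>
    exact ih.comp (((measurable_update (by fun_prop)
      ((measurable_arith op).comp ((hnum i).prodMk (hnum j))) dst).prodMk
      (by fun_prop)).prodMk (husage fun u => ⟨u.calls, u.evals, u.ops + 1⟩))
  | branch i j yes no ihy ihn =>
    have h := husage fun u => ⟨u.calls, u.evals, u.ops + 1⟩
    exact (ihy.comp (measurable_fst.prodMk h)).ite (ihn.comp (measurable_fst.prodMk h))
      (measurableSet_le (hnum i) (hnum j))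
  | eval dst i p next ih =>
    -- The time read from a register is a natural number, so a fixed time suffices by countability.
    have h : Measurable fun q : ℕ × SamplePath T D => evalPayout g q.1 q.2 :=
      measurable_from_prod_countable_right fun n => measurable_evalPayout hg n
    exact ih.comp (((measurable_update (by fun_prop)
      (h.comp ((Nat.measurable_floor.comp (hnum i)).prodMk (hpath p))) dst).prodMk
      (by fun_prop)).prodMk (husage fun u => ⟨u.calls, u.evals + 1, u.ops⟩))
  | sample dst i p next ih =>
    have h : Measurable fun q : ℕ × SamplePath T D => simulate B q.1 q.2 :=
      measurable_from_prod_countable_right fun n => measurable_simulate B n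
    have h1 : IsSubProb fun q : Frame T D × Usage => simulate B ⌊q.1.1 i⌋₊ (q.1.2 p) :=
      .of_isProbabilityMeasure
        (h.comp ((Nat.measurable_floor.comp (hnum i)).prodMk (hpath p))) fun _ => inferInstance
    have h2 : Measurable fun q : (Frame T D × Usage) × SamplePath T D =>
        (((q.1.1.1, Function.update q.1.1.2 dst q.2), ⟨q.1.2.calls + 1, q.1.2.evals, q.1.2.ops⟩) :
          Frame T D × Usage) := by
      refine Measurable.prodMk (Measurable.prodMk (by fun_prop) ?_) ?_
      · exact measurable_update (by fun_prop) measurable_snd dst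
      · exact (husage fun u => ⟨u.calls + 1, u.evals, u.ops⟩).comp measurable_fst
    have h3 := ih.comp h2
    have h4 := h1.bind h3
    dsimp only at h4
    exact h4
  | call dst f xs ps next ih =>
    have hpass : Measurable fun q : Frame T D × Usage => q.1.pass xs ps := by
      refine Measurable.prodMk (measurable_pi_iff.2 fun n => ?_) (measurable_pi_iff.2 fun n => ?_)
      · cases h : xs[n]? <;> simp
        exact hnum _
      · cases h : ps[n]? <;> simp
        exact hpath _
    have h1 : IsSubProb fun q : Frame T D × Usage => callee f (q.1.pass xs ps) q.2 :=
      (hcallee f).comp (hpass.prodMk measurable_snd)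
    have h2 : Measurable fun q : (Frame T D × Usage) × Outcome =>
        (((Function.update q.1.1.1 dst q.2.1, q.1.1.2), q.2.2) : Frame T D × Usage) := by
      refine Measurable.prodMk (Measurable.prodMk ?_ (by fun_prop)) (by fun_prop)
      exact measurable_update (by fun_prop) (by fun_prop) dst
    have h3 := ih.comp h2
    have h4 := h1.bind h3
    dsimp only at h4
    exact h4

theorem isSubProb_run {g : Payouts T D} (hg : ∀ i, Measurable (g i)) {B : Simulator T D}
    [∀ t, IsMarkovKernel (B t)] (A : Program) (d f : ℕ) :
    IsSubProb fun p : Frame T D × Usage => run A g B d f p.1 p.2 := by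
  induction d generalizing f with
  | zero => exact ⟨measurable_const, fun a => by simp [run]⟩
  | succ d ih => exact isSubProb_exec hg ih _

end Semantics

/-! ### Resource usage -/

instance : Zero Usage := ⟨⟨0, 0, 0⟩⟩

instance : Add Usage := ⟨fun u v => ⟨u.calls + v.calls, u.evals + v.evals, u.ops + v.ops⟩⟩

/-- The total number of instructions charged for. -/
def Usage.size (u : Usage) : ℕ := u.calls + u.evals + u.ops

theorem Usage.add_assoc' (u v w : Usage) : u + (v + w) = u + v + w := by
  change Usage.mk _ _ _ = Usage.mk _ _ _
  congr 1 <;> exact (Nat.add_assoc _ _ _).symm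

@[simp]
theorem Usage.size_add (u v : Usage) : (u + v).size = u.size + v.size := by
  change _ + _ + (_ + _) + (_ + _) = _
  unfold Usage.size
  ring

@[simp]
theorem Usage.size_zero : (0 : Usage).size = 0 := rfl

@[simp]
theorem Usage.size_mk (a b c : ℕ) : (Usage.mk a b c).size = a + b + c := rfl

theorem Usage.time_le {C G : ℝ} (hC : 0 ≤ C) (hG : 0 ≤ G) (u : Usage) :
    u.time C G ≤ (C + G + 1) * u.size := by
  have h1 : (0 : ℝ) ≤ u.calls := Nat.cast_nonneg _
  have h2 : (0 : ℝ) ≤ u.evals := Nat.cast_nonneg _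
  have h3 : (0 : ℝ) ≤ u.ops := Nat.cast_nonneg _
  unfold Usage.time Usage.size
  push_cast
  nlinarith [mul_nonneg hC h2, mul_nonneg hC h3, mul_nonneg hG h1, mul_nonneg hG h3]

/-! ### Code with deterministic resource usage -/

/-- The outcome has a value of law `μ`, and the resources `c` are used. -/
def Yields (ν : Usage → Measure Outcome) (μ : Measure ℝ) (c : Usage) : Prop :=
  ∀ u, ν u = μ.map fun x => (x, u + c)

section Rules

variable {T D : ℕ} {g : Payouts T D} {B : Simulator T D}
  {callee : ℕ → Frame T D → Usage → Measure Outcome} {s : Frame T D} {μ : Measure ℝ} {c : Usage}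

theorem yields_ret {i : ℕ} {x : ℝ} (hx : s.1 i = x) :
    Yields (exec g B callee (.ret i) s) (Measure.dirac x) 0 := by
  intro u
  subst hx
  have h : Measurable fun x : ℝ => (x, u + 0) := by fun_prop
  rw [exec, Measure.map_dirac' h]
  rfl

theorem yields_lit {dst : ℕ} {q : ℚ} {next : Code}
    (h : Yields (exec g B callee next (Function.update s.1 dst (q : ℝ), s.2)) μ c) :
    Yields (exec g B callee (.lit dst q next) s) μ c :=
  fun u => by rw [exec, h u]

theorem yields_arith {op : ArithOp} {dst i j : ℕ} {next : Code}
    (h : Yields (exec g B callee next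
      (Function.update s.1 dst (op.apply (s.1 i) (s.1 j)), s.2)) μ c) :
    Yields (exec g B callee (.arith op dst i j next) s) μ (⟨0, 0, 1⟩ + c) :=
  fun u => by
    rw [exec, h]
    simp only [Usage.add_assoc']
    rfl

theorem yields_branch_yes {i j : ℕ} {yes no : Code} (hij : s.1 i ≤ s.1 j)
    (h : Yields (exec g B callee yes s) μ c) :
    Yields (exec g B callee (.branch i j yes no) s) μ (⟨0, 0, 1⟩ + c) :=
  fun u => by
    rw [exec, if_pos hij, h]
    simp only [Usage.add_assoc']
    rfl

theorem yields_branch_no {i j : ℕ} {yes no : Code} (hij : s.1 j < s.1 i)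
    (h : Yields (exec g B callee no s) μ c) :
    Yields (exec g B callee (.branch i j yes no) s) μ (⟨0, 0, 1⟩ + c) :=
  fun u => by
    rw [exec, if_neg hij.not_ge, h]
    simp only [Usage.add_assoc']
    rfl

theorem yields_eval {dst i p : ℕ} {next : Code}
    (h : Yields (exec g B callee next
      (Function.update s.1 dst (evalPayout g ⌊s.1 i⌋₊ (s.2 p)), s.2)) μ c) :
    Yields (exec g B callee (.eval dst i p next) s) μ (⟨0, 1, 0⟩ + c) :=
  fun u => by
    rw [exec, h]
    simp only [Usage.add_assoc']
    rfl

theorem yields_sample {dst i p n : ℕ} {next : Code} {η : SamplePath T D → Measure ℝ}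
    (hη : Measurable η) (hn : s.1 i = n)
    (h : ∀ y, Yields (exec g B callee next (s.1, Function.update s.2 dst y)) (η y) c) :
    Yields (exec g B callee (.sample dst i p next) s)
      ((simulate B n (s.2 p)).bind η) (⟨1, 0, 0⟩ + c) :=
  fun u => by
    rw [exec, hn, Nat.floor_natCast, ← bind_map_right hη (by fun_prop)]
    congr 1
    ext1 y
    rw [h y]
    simp only [Usage.add_assoc']
    rfl

/-- The callee's outcome is an image of `μ` with constant usage, so the remaining code is averaged
over `μ` alone and the two usages add; `hexec` justifies moving the image through the `bind`. -/
theorem yields_call {dst f : ℕ} {xs ps : List ℕ} {next : Code} {η : ℝ → Measure ℝ} {c' : Usage}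
    (hη : Measurable η) (hcallee : Yields (callee f (s.pass xs ps)) μ c)
    (h : ∀ x, Yields (exec g B callee next (Function.update s.1 dst x, s.2)) (η x) c')
    (hexec : Measurable fun p : Frame T D × Usage => exec g B callee next p.1 p.2) :
    Yields (exec g B callee (.call dst f xs ps next) s) (μ.bind η) (c + c') :=
  fun u => by
    have hm : Measurable fun o : Outcome =>
        exec g B callee next (Function.update s.1 dst o.1, s.2) o.2 := by
      have h1 : Measurable fun o : Outcome =>
          (((Function.update s.1 dst o.1, s.2), o.2) : Frame T D × Usage) := by
        refine Measurable.prodMk (Measurable.prodMk ?_ (by fun_prop)) (by fun_prop)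
        exact measurable_update (by fun_prop) (by fun_prop) dst
      exact hexec.comp h1
    rw [exec, hcallee u, bind_map_left (by fun_prop) hm, ← bind_map_right hη (by fun_prop)]
    congr 1
    ext1 x
    rw [h x]
    simp only [Usage.add_assoc']

end Rules

/-! ### The program -/

/-- Estimates the value function of level `k` at time `n`, averaging `N` samples at each level.
Arguments: `k`, `n`, `N`, `T` and the path. -/
def estimateCode : Code :=
  .lit 4 0 <| .branch 0 4
    (.eval 5 1 0 <| .ret 5)
    (.lit 4 1 <| .arith .sub 0 0 4 <| .call 5 1 [0, 1, 2, 3] [0] <|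
      .call 6 2 [0, 1, 2, 3, 2] [0] <| .arith .div 6 6 2 <| .arith .sub 5 5 6 <| .ret 5)

/-- Sums the estimates of the pathwise minimum at level `k` over `c` paths sampled at time `n`.
Arguments: `k`, `n`, `N`, `T`, `c` and the path. -/
def sumCode : Code :=
  .lit 5 0 <| .branch 4 5
    (.ret 5)
    (.sample 1 1 0 <| .call 6 3 [0, 3, 2, 3] [1] <| .lit 5 1 <| .arith .sub 4 4 5 <|
      .call 7 2 [0, 1, 2, 3, 4] [0] <| .arith .add 6 6 7 <| .ret 6)

/-- Estimates the minimum, clipped to the unit interval, of the value function of level `k` over the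
times `1, …, i` of a path. Arguments: `k`, `i`, `N`, `T` and the path. -/
def minCode : Code :=
  .lit 4 1 <| .branch 4 1
    (.call 5 1 [0, 1, 2, 3] [0] <| .lit 6 0 <| .arith .max 5 5 6 <| .arith .sub 1 1 4 <|
      .call 6 3 [0, 1, 2, 3] [0] <| .arith .min 5 5 6 <| .ret 5)
    (.ret 4)

/-- Searches for the number of levels. Arguments: `ε`, `δ`, `T`, the current number `K` of levels,
and `64 ^ K`. -/
def levelCode : Code :=
  .lit 5 2 <| .arith .mul 6 0 3 <| .branch 5 6
    (.arith .mul 4 4 2 <| .call 7 5 [1, 2, 3, 4, 4] [] <| .ret 7)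
    (.lit 5 1 <| .arith .add 3 3 5 <| .lit 5 64 <| .arith .mul 4 4 5 <|
      .call 7 4 [0, 1, 2, 3, 4] [] <| .ret 7)

/-- Searches for the number of samples, and starts the estimation. Arguments: `δ` times a power of
two, `T`, the number of levels, the increment of the number of samples, and the current number of
samples. -/
def sampleSizeCode : Code :=
  .lit 5 1 <| .branch 5 0
    (.lit 6 0 <| .call 7 1 [2, 6, 4, 1] [] <| .arith .sub 7 6 7 <| .ret 7)
    (.arith .add 0 0 0 <| .arith .add 4 4 3 <| .call 7 5 [0, 1, 2, 3, 4] [] <| .ret 7)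

/-- The main procedure. Arguments: `ε`, `δ`, `T`. -/
def mainCode : Code :=
  .lit 3 0 <| .lit 4 1 <| .call 5 4 [0, 1, 2, 3, 4] [] <| .ret 5

/-- The algorithm. -/
def algorithm : Program :=
  [mainCode, estimateCode, sumCode, minCode, levelCode, sampleSizeCode]

/-! ### The laws of the estimates -/

/-- The law of the clipped minimum of independent estimates of laws `est 1, …, est i`. -/
noncomputable def minLaw (est : ℕ → Measure ℝ) : ℕ → Measure ℝ
  | 0 => Measure.dirac 1
  | i + 1 => (est (i + 1)).bind fun x => (minLaw est i).bind fun r =>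
      Measure.dirac (min (max x 0) r)

/-- The law of the sum of `c` independent random variables of law `μ`. -/
noncomputable def sumLaw (μ : Measure ℝ) : ℕ → Measure ℝ
  | 0 => Measure.dirac 0
  | c + 1 => μ.bind fun x => (sumLaw μ c).bind fun r => Measure.dirac (x + r)

/-- The law of the estimate of the value function of level `k` at time `n`. -/
noncomputable def estLaw {T D : ℕ} (g : Payouts T D) (B : Simulator T D) (N : ℕ) :
    ℕ → ℕ → SamplePath T D → Measure ℝ
  | 0, n, y => Measure.dirac (evalPayout g n y)
  | k + 1, n, y => (estLaw g B N k n y).bind fun x =>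
      (sumLaw ((simulate B n y).bind fun z => minLaw (fun i => estLaw g B N k i z) T) N).bind
        fun a => Measure.dirac (x - a / N)

section Laws

theorem measurable_bind_dirac (μ : Measure ℝ) [IsProbabilityMeasure μ] {f : ℝ × ℝ → ℝ}
    (hf : Measurable f) : Measurable fun x => μ.bind fun r => Measure.dirac (f (x, r)) := by
  have h : IsSubProb fun _ : ℝ => μ := .of_isProbabilityMeasure measurable_const fun _ => ‹_›
  exact (h.bind (isSubProb_dirac hf)).measurable

theorem isProbabilityMeasure_bind_dirac (μ : Measure ℝ) [IsProbabilityMeasure μ] {f : ℝ → ℝ}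
    (hf : Measurable f) : IsProbabilityMeasure (μ.bind fun r => Measure.dirac (f r)) :=
  isProbabilityMeasure_bind (Measure.measurable_dirac.comp hf) fun _ => inferInstance

theorem isProbabilityMeasure_minLaw {est : ℕ → Measure ℝ} (h : ∀ i, IsProbabilityMeasure (est i))
    (i : ℕ) : IsProbabilityMeasure (minLaw est i) := by
  induction i with
  | zero => rw [minLaw]; infer_instance
  | succ i ih =>
    exact isProbabilityMeasure_bind
      (measurable_bind_dirac _ (f := fun p => min (max p.1 0) p.2) (by fun_prop))
      fun x => isProbabilityMeasure_bind_dirac _ (by fun_prop)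

theorem measurable_minLaw {α : Type*} [MeasurableSpace α] {est : α → ℕ → Measure ℝ}
    (h : ∀ a i, IsProbabilityMeasure (est a i)) (hm : ∀ i, Measurable fun a => est a i) (i : ℕ) :
    Measurable fun a => minLaw (est a) i := by
  induction i with
  | zero => exact measurable_const
  | succ i ih =>
    have h1 : IsSubProb fun a => est a (i + 1) := .of_isProbabilityMeasure (hm _) fun a => h a _
    have h2 : IsSubProb fun p : α × ℝ => minLaw (est p.1) i :=
      .of_isProbabilityMeasure (ih.comp measurable_fst) fun p => isProbabilityMeasure_minLaw (h _) i
    have h3 : IsSubProb fun q : (α × ℝ) × ℝ =>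
      (Measure.dirac (min (max q.1.2 0) q.2) : Measure ℝ) := isSubProb_dirac (by fun_prop)
    exact (h1.bind (h2.bind h3)).measurable

theorem isProbabilityMeasure_sumLaw {μ : Measure ℝ} [IsProbabilityMeasure μ] (c : ℕ) :
    IsProbabilityMeasure (sumLaw μ c) := by
  induction c with
  | zero => rw [sumLaw]; infer_instance
  | succ c ih =>
    exact isProbabilityMeasure_bind
      (measurable_bind_dirac _ (f := fun p => p.1 + p.2) (by fun_prop))
      fun x => isProbabilityMeasure_bind_dirac _ (by fun_prop)

theorem measurable_sumLaw {α : Type*} [MeasurableSpace α] {μ : α → Measure ℝ}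
    (h : ∀ a, IsProbabilityMeasure (μ a)) (hm : Measurable μ) (c : ℕ) :
    Measurable fun a => sumLaw (μ a) c := by
  induction c with
  | zero => exact measurable_const
  | succ c ih =>
    have h1 : IsSubProb μ := .of_isProbabilityMeasure hm h
    have h2 : IsSubProb fun p : α × ℝ => sumLaw (μ p.1) c :=
      .of_isProbabilityMeasure (ih.comp measurable_fst) fun p => isProbabilityMeasure_sumLaw c
    have h3 : IsSubProb fun q : (α × ℝ) × ℝ =>
      (Measure.dirac (q.1.2 + q.2) : Measure ℝ) := isSubProb_dirac (by fun_prop)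
    exact (h1.bind (h2.bind h3)).measurable

/-- Both halves are proved in one induction: forming the next level's `bind`s uses total mass one
and measurability of the previous level. -/
theorem estLaw_spec {T D : ℕ} {g : Payouts T D} (hg : ∀ i, Measurable (g i)) (B : Simulator T D)
    [∀ t, IsMarkovKernel (B t)] (N k : ℕ) : (∀ n y, IsProbabilityMeasure (estLaw g B N k n y)) ∧
    ∀ n, Measurable (estLaw g B N k n) := by
  induction k with
  | zero =>
    exact ⟨fun n y => by rw [estLaw]; infer_instance,
      fun n => Measure.measurable_dirac.comp (measurable_evalPayout hg n)⟩
  | succ k ih =>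
    obtain ⟨ih1, ih2⟩ := ih
    have hmin : Measurable fun z : SamplePath T D => minLaw (fun i => estLaw g B N k i z) T :=
      measurable_minLaw (fun a i => ih1 i a) ih2 T
    have hmin' : ∀ z, IsProbabilityMeasure (minLaw (fun i => estLaw g B N k i z) T) :=
      fun z => isProbabilityMeasure_minLaw (fun i => ih1 i z) T
    have hs : ∀ n y, IsProbabilityMeasure
        ((simulate B n y).bind fun z => minLaw (fun i => estLaw g B N k i z) T) :=
      fun n y => isProbabilityMeasure_bind hmin hmin'
    have hs' : ∀ n, Measurable fun y : SamplePath T D =>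
        (simulate B n y).bind fun z => minLaw (fun i => estLaw g B N k i z) T := fun n =>
      (Measure.measurable_bind' hmin).comp (measurable_simulate B n)
    refine ⟨fun n y => ?_, fun n => ?_⟩
    · have h1 := ih1 n y
      have h2 := hs n y
      have h3 := isProbabilityMeasure_sumLaw
        (μ := (simulate B n y).bind fun z => minLaw (fun i => estLaw g B N k i z) T) N
      exact isProbabilityMeasure_bind
        (measurable_bind_dirac _ (f := fun p => p.1 - p.2 / N) (by fun_prop))
        fun x => isProbabilityMeasure_bind_dirac _ (by fun_prop)
    · have h1 : IsSubProb (estLaw g B N k n) := .of_isProbabilityMeasure (ih2 n) (ih1 n)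
      have h2 : IsSubProb fun p : SamplePath T D × ℝ =>
          sumLaw ((simulate B n p.1).bind fun z => minLaw (fun i => estLaw g B N k i z) T) N :=
        .of_isProbabilityMeasure ((measurable_sumLaw (hs n) (hs' n) N).comp measurable_fst)
          fun p => by
            have := hs n p.1
            exact isProbabilityMeasure_sumLaw N
      have h3 : IsSubProb fun q : (SamplePath T D × ℝ) × ℝ =>
        (Measure.dirac (q.1.2 - q.2 / N) : Measure ℝ) := isSubProb_dirac (by fun_prop)
      exact (h1.bind (h2.bind h3)).measurable

end Laws

/-! ### The procedures realize the laws of the estimates -/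

/-- A bound on the resources used by the estimation at level `k`. -/
def estCost (T N : ℕ) : ℕ → ℕ
  | 0 => 2
  | k + 1 => estCost T N k + 5 + N * (5 + T * (estCost T N k + 4))

section Procedures

variable {T D : ℕ}

/-- Procedure `estimateCode` realizes `estLaw` at level `k`. -/
def EstimateSpec (g : Payouts T D) (B : Simulator T D) (N k : ℕ) : Prop :=
  ∃ c : Usage, c.size ≤ estCost T N k ∧ ∃ d₀, ∀ d ≥ d₀, ∀ (s : Frame T D) (n : ℕ),
    s.1 0 = k → s.1 1 = n → s.1 2 = N → s.1 3 = T →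
      Yields (run algorithm g B d 1 s) (estLaw g B N k n (s.2 0)) c

theorem measurable_exec_run {g : Payouts T D} (hg : ∀ i, Measurable (g i)) {B : Simulator T D}
    [∀ t, IsMarkovKernel (B t)] (A : Program) (d : ℕ) (c : Code) :
    Measurable fun p : Frame T D × Usage => exec g B (run A g B d) c p.1 p.2 :=
  (isSubProb_exec hg (isSubProb_run hg _ _) _).measurable

/-- Each time costs one estimate plus four operations (comparison, `max`, decrement, `min`); the
last comparison gives the 1. The depth threshold is uniform over frames because recursive calls
change the frame. -/
theorem minCode_spec {g : Payouts T D} (hg : ∀ i, Measurable (g i)) {B : Simulator T D}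
    [∀ t, IsMarkovKernel (B t)] {N k : ℕ} (hest : EstimateSpec g B N k) (i : ℕ) :
    ∃ c : Usage, c.size ≤ 1 + i * (estCost T N k + 4) ∧ ∃ d₀, ∀ d ≥ d₀, ∀ s : Frame T D,
      s.1 0 = k → s.1 1 = i → s.1 2 = N → s.1 3 = T →
        Yields (run algorithm g B d 3 s) (minLaw (fun i => estLaw g B N k i (s.2 0)) i) c := by
  have hlaw := estLaw_spec hg B N k
  induction i with
  | zero =>
    refine ⟨⟨0, 0, 1⟩ + 0, by simp, 1, fun d hd s h0 h1 h2 h3 => ?_⟩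
    obtain ⟨d, rfl⟩ := Nat.exists_eq_add_of_le' hd
    exact yields_lit (yields_branch_no (by simp [h1]) (yields_ret (by simp)))
  | succ i ih =>
    obtain ⟨c₁, hc₁, d₁, hd₁⟩ := hest
    obtain ⟨c₂, hc₂, d₂, hd₂⟩ := ih
    refine ⟨⟨0, 0, 1⟩ + (c₁ + (⟨0, 0, 1⟩ + (⟨0, 0, 1⟩ + (c₂ + (⟨0, 0, 1⟩ + 0))))), ?_,
      max d₁ d₂ + 1, fun d hd s h0 h1 h2 h3 => ?_⟩
    · simp only [Usage.size_add, Usage.size_mk, Usage.size_zero]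
      linarith
    · obtain ⟨d, rfl⟩ := Nat.exists_eq_add_of_le' (le_trans (Nat.le_add_left 1 _) hd)
      have hl := fun j => hlaw.1 j (s.2 0)
      have := isProbabilityMeasure_minLaw hl i
      refine yields_lit (yields_branch_yes (by simp [h1]) (yields_call
        (measurable_bind_dirac _ (f := fun p => min (max p.1 0) p.2) (by fun_prop))
        (hd₁ d (by omega) _ (i + 1) ?_ ?_ ?_ ?_) (fun x => yields_lit (yields_arith (yields_arith
          (yields_call (Measure.measurable_dirac.comp (by fun_prop))
            (hd₂ d (by omega) _ ?_ ?_ ?_ ?_) (fun r => yields_arith (yields_ret ?_))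
            (measurable_exec_run hg _ _ _)))))
        (measurable_exec_run hg _ _ _)))
      all_goals simp [Frame.pass, ArithOp.apply, h0, h1, h2, h3]

theorem sumCode_spec {g : Payouts T D} (hg : ∀ i, Measurable (g i)) {B : Simulator T D}
    [∀ t, IsMarkovKernel (B t)] {N k : ℕ} (hest : EstimateSpec g B N k) (c : ℕ) :
    ∃ r : Usage, r.size ≤ 1 + c * (5 + T * (estCost T N k + 4)) ∧ ∃ d₀, ∀ d ≥ d₀,
      ∀ (s : Frame T D) (n : ℕ), s.1 0 = k → s.1 1 = n → s.1 2 = N → s.1 3 = T → s.1 4 = c →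
        Yields (run algorithm g B d 2 s) (sumLaw ((simulate B n (s.2 0)).bind
          fun z => minLaw (fun i => estLaw g B N k i z) T) c) r := by
  have hlaw := estLaw_spec hg B N k
  have hmin : Measurable fun z : SamplePath T D => minLaw (fun i => estLaw g B N k i z) T :=
    measurable_minLaw (fun a i => hlaw.1 i a) hlaw.2 T
  have hmin' : ∀ z, IsProbabilityMeasure (minLaw (fun i => estLaw g B N k i z) T) :=
    fun z => isProbabilityMeasure_minLaw (fun i => hlaw.1 i z) T
  induction c with
  | zero =>
    refine ⟨⟨0, 0, 1⟩ + 0, by simp, 1, fun d hd s n h0 h1 h2 h3 h4 => ?_⟩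
    obtain ⟨d, rfl⟩ := Nat.exists_eq_add_of_le' hd
    exact yields_lit (yields_branch_yes (by simp [h4]) (yields_ret (by simp)))
  | succ c ih =>
    obtain ⟨c₁, hc₁, d₁, hd₁⟩ := minCode_spec hg hest T
    obtain ⟨c₂, hc₂, d₂, hd₂⟩ := ih
    refine ⟨⟨0, 0, 1⟩ + (⟨1, 0, 0⟩ + (c₁ + (⟨0, 0, 1⟩ + (c₂ + (⟨0, 0, 1⟩ + 0))))), ?_,
      max d₁ d₂ + 1, fun d hd s n h0 h1 h2 h3 h4 => ?_⟩
    · simp only [Usage.size_add, Usage.size_mk, Usage.size_zero]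
      linarith
    · obtain ⟨d, rfl⟩ := Nat.exists_eq_add_of_le' (le_trans (Nat.le_add_left 1 _) hd)
      have hs : IsProbabilityMeasure ((simulate B n (s.2 0)).bind
          fun z => minLaw (fun i => estLaw g B N k i z) T) := isProbabilityMeasure_bind hmin hmin'
      have := isProbabilityMeasure_sumLaw (μ := (simulate B n (s.2 0)).bind
          fun z => minLaw (fun i => estLaw g B N k i z) T) c
      have hη := measurable_bind_dirac (sumLaw ((simulate B n (s.2 0)).bind
          fun z => minLaw (fun i => estLaw g B N k i z) T) c) (f := fun p => p.1 + p.2)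
          (by fun_prop)
      have hη' : Measurable fun z : SamplePath T D =>
          (minLaw (fun i => estLaw g B N k i z) T).bind fun x =>
            (sumLaw ((simulate B n (s.2 0)).bind
              fun z => minLaw (fun i => estLaw g B N k i z) T) c).bind
                fun r => Measure.dirac (x + r) := (Measure.measurable_bind' hη).comp hmin
      -- Reassociated so that the drawn path is the outermost variable, as in the code, which
      -- samples before minimizing.
      rw [sumLaw, Measure.bind_bind hmin.aemeasurable hη.aemeasurable]
      refine yields_lit (yields_branch_no ?_ (yields_sample hη' ?_ fun z => ?_))
      rotate_left 2
      · refine yields_call hη ?_ (fun x => yields_lit (yields_arith (yields_call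
          (Measure.measurable_dirac.comp (by fun_prop)) ?_ (fun r => yields_arith (yields_ret ?_))
          (measurable_exec_run hg _ _ _)))) (measurable_exec_run hg _ _ _)
        · have h := hd₁ d (by omega) (Frame.pass (Function.update s.1 5 (0 : ℚ),
            Function.update s.2 1 z) [0, 3, 2, 3] [1])
            (by simp [Frame.pass, h0]) (by simp [Frame.pass, h3]) (by simp [Frame.pass, h2])
            (by simp [Frame.pass, h3])
          simpa [Frame.pass] using h
        · refine hd₂ d (by omega) _ n ?_ ?_ ?_ ?_ ?_
          all_goals simp [Frame.pass, ArithOp.apply, h0, h1, h2, h3, h4]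
        · simp [ArithOp.apply]
      · simp [h4]; positivity
      · simp [h1]

theorem estimateCode_spec {g : Payouts T D} (hg : ∀ i, Measurable (g i)) (B : Simulator T D)
    [∀ t, IsMarkovKernel (B t)] (N k : ℕ) : EstimateSpec g B N k := by
  induction k with
  | zero =>
    refine ⟨⟨0, 0, 1⟩ + (⟨0, 1, 0⟩ + 0), by simp [estCost], 1, fun d hd s n h0 h1 h2 h3 => ?_⟩
    obtain ⟨d, rfl⟩ := Nat.exists_eq_add_of_le' hd
    exact yields_lit (yields_branch_yes (by simp [h0]) (yields_eval (yields_ret (by simp [h1]))))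
  | succ k ih =>
    have hlaw := estLaw_spec hg B N k
    have hmin : Measurable fun z : SamplePath T D => minLaw (fun i => estLaw g B N k i z) T :=
      measurable_minLaw (fun a i => hlaw.1 i a) hlaw.2 T
    have hmin' : ∀ z, IsProbabilityMeasure (minLaw (fun i => estLaw g B N k i z) T) :=
      fun z => isProbabilityMeasure_minLaw (fun i => hlaw.1 i z) T
    obtain ⟨c₂, hc₂, d₂, hd₂⟩ := sumCode_spec hg ih N
    obtain ⟨c₁, hc₁, d₁, hd₁⟩ := ih
    refine ⟨⟨0, 0, 1⟩ + (⟨0, 0, 1⟩ + (c₁ + (c₂ + (⟨0, 0, 1⟩ + (⟨0, 0, 1⟩ + 0))))), ?_,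
      max d₁ d₂ + 1, fun d hd s n h0 h1 h2 h3 => ?_⟩
    · simp only [Usage.size_add, Usage.size_mk, Usage.size_zero, estCost]
      linarith
    · obtain ⟨d, rfl⟩ := Nat.exists_eq_add_of_le' (le_trans (Nat.le_add_left 1 _) hd)
      have hs : IsProbabilityMeasure ((simulate B n (s.2 0)).bind
          fun z => minLaw (fun i => estLaw g B N k i z) T) := isProbabilityMeasure_bind hmin hmin'
      have := isProbabilityMeasure_sumLaw (μ := (simulate B n (s.2 0)).bind
          fun z => minLaw (fun i => estLaw g B N k i z) T) N
      refine yields_lit (yields_branch_no ?_ (yields_lit (yields_arith (yields_call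
        (measurable_bind_dirac _ (f := fun p => p.1 - p.2 / N) (by fun_prop))
        (hd₁ d (by omega) _ n ?_ ?_ ?_ ?_) (fun x => yields_call
          (Measure.measurable_dirac.comp (by fun_prop))
          (hd₂ d (by omega) _ n ?_ ?_ ?_ ?_ ?_)
          (fun a => yields_arith (yields_arith (yields_ret ?_)))
          (measurable_exec_run hg _ _ _))
        (measurable_exec_run hg _ _ _)))))
      · simp [h0]; positivity
      all_goals simp [Frame.pass, ArithOp.apply, h0, h1, h2, h3]

end Procedures

/-! ### Computing the number of levels and the sample size by counting -/

section Search

variable {T D : ℕ}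

/-- Doubling `p` until it reaches one replaces a logarithm, each doubling adding `base` samples. The
estimation starts at time 0, and its negative is returned because the value function there is minus
the approximation of the optimum. -/
theorem sampleSizeCode_spec {g : Payouts T D} (hg : ∀ i, Measurable (g i)) (B : Simulator T D)
    [∀ t, IsMarkovKernel (B t)] (K base m N : ℕ) {p : ℝ} (hm : 1 ≤ p * 2 ^ m)
    (hm' : ∀ i < m, p * 2 ^ i < 1) :
    ∃ c : Usage, c.size ≤ 3 * m + 2 + estCost T (N + m * base) K ∧ ∃ d₀, ∀ d ≥ d₀,
      ∀ s : Frame T D, s.1 0 = p → s.1 1 = T → s.1 2 = K → s.1 3 = base → s.1 4 = N → s.2 0 = 0 →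
        Yields (run algorithm g B d 5 s)
          ((estLaw g B (N + m * base) K 0 0).bind fun x => Measure.dirac (0 - x)) c := by
  induction m generalizing p N with
  | zero =>
    obtain ⟨c₁, hc₁, d₁, hd₁⟩ := estimateCode_spec hg B N K
    refine ⟨⟨0, 0, 1⟩ + (c₁ + (⟨0, 0, 1⟩ + 0)), ?_, d₁ + 1, fun d hd s h0 h1 h2 h3 h4 h5 => ?_⟩
    · simp only [Usage.size_add, Usage.size_mk, Usage.size_zero, zero_mul, add_zero]
      omega
    obtain ⟨d, rfl⟩ := Nat.exists_eq_add_of_le' (le_trans (Nat.le_add_left 1 _) hd)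
    refine yields_lit (yields_branch_yes ?_ (yields_lit (yields_call
      (Measure.measurable_dirac.comp (by fun_prop)) ?_ (fun x => yields_arith (yields_ret ?_))
      (measurable_exec_run hg _ _ _))))
    · simpa [h0] using hm
    · have h := hd₁ d (by omega) (Frame.pass (Function.update (Function.update s.1 5 (1 : ℚ)) 6
        (0 : ℚ), s.2) [2, 6, 4, 1] []) 0
      simpa [Frame.pass, h0, h1, h2, h3, h4] using h
    · simp [ArithOp.apply]
  | succ m ih =>
    obtain ⟨c₁, hc₁, d₁, hd₁⟩ := ih (N + base) (p := p + p)
      (by rw [pow_succ] at hm; linarith) fun i hi => by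
        have := hm' (i + 1) (by omega)
        rw [pow_succ] at this
        linarith
    have hN : N + (m + 1) * base = N + base + m * base := by ring
    rw [hN]
    refine ⟨⟨0, 0, 1⟩ + (⟨0, 0, 1⟩ + (⟨0, 0, 1⟩ + (c₁ + 0))), ?_, d₁ + 1,
      fun d hd s h0 h1 h2 h3 h4 h5 => ?_⟩
    · simp only [Usage.size_add, Usage.size_mk, Usage.size_zero]
      omega
    obtain ⟨d, rfl⟩ := Nat.exists_eq_add_of_le' (le_trans (Nat.le_add_left 1 _) hd)
    -- A call whose result is returned unchanged contributes a trivial last stage.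
    rw [← Measure.bind_dirac (m := (estLaw g B (N + base + m * base) K 0 0).bind _)]
    refine yields_lit (yields_branch_no ?_ (yields_arith (yields_arith (yields_call
      Measure.measurable_dirac (hd₁ d (by omega) _ ?_ ?_ ?_ ?_ ?_ ?_) (fun x => yields_ret ?_)
      (measurable_exec_run hg _ _ _)))))
    · simpa [h0] using hm' 0 (by omega)
    all_goals simp [Frame.pass, ArithOp.apply, h0, h1, h2, h3, h4]

/-- Here `j` counts the levels still to be added; each multiplies `M` by 64, so no division 2/ε and
no power is ever computed. -/
theorem levelCode_spec {g : Payouts T D} (hg : ∀ i, Measurable (g i)) (B : Simulator T D)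
    [∀ t, IsMarkovKernel (B t)] {ε δ : ℝ} {m : ℕ} (hm : 1 ≤ δ * 2 ^ m)
    (hm' : ∀ i < m, δ * 2 ^ i < 1) (j k M : ℕ) (hj : 2 ≤ ε * (k + j : ℕ))
    (hj' : ∀ i < j, ε * (k + i : ℕ) < 2) :
    ∃ c : Usage,
      c.size ≤ 4 * j + 3 * m + 5 + estCost T ((m + 1) * (M * 64 ^ j * T)) (k + j) ∧
      ∃ d₀, ∀ d ≥ d₀,
      ∀ s : Frame T D, s.1 0 = ε → s.1 1 = δ → s.1 2 = T → s.1 3 = k → s.1 4 = M →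
        Yields (run algorithm g B d 4 s)
          ((estLaw g B ((m + 1) * (M * 64 ^ j * T)) (k + j) 0 0).bind
            fun x => Measure.dirac (0 - x)) c := by
  induction j generalizing k M with
  | zero =>
    obtain ⟨c₁, hc₁, d₁, hd₁⟩ := sampleSizeCode_spec hg B k (M * T) m (M * T) hm hm'
    -- The same number serves as initial sample size and as increment, hence the factor `m + 1`.
    have hN : (m + 1) * (M * 64 ^ 0 * T) = M * T + m * (M * T) := by ring
    rw [hN]
    refine ⟨⟨0, 0, 1⟩ + (⟨0, 0, 1⟩ + (⟨0, 0, 1⟩ + (c₁ + 0))), ?_, d₁ + 1,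
      fun d hd s h0 h1 h2 h3 h4 => ?_⟩
    · simp only [Usage.size_add, Usage.size_mk, Usage.size_zero, add_zero]
      omega
    obtain ⟨d, rfl⟩ := Nat.exists_eq_add_of_le' (le_trans (Nat.le_add_left 1 _) hd)
    rw [← Measure.bind_dirac (m := (estLaw g B (M * T + m * (M * T)) (k + 0) 0 0).bind _)]
    refine yields_lit (yields_arith (yields_branch_yes ?_ (yields_arith (yields_call
      Measure.measurable_dirac (hd₁ d (by omega) _ ?_ ?_ ?_ ?_ ?_ ?_) (fun x => yields_ret ?_)
      (measurable_exec_run hg _ _ _)))))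
    · simpa [h0, h3, ArithOp.apply] using hj
    all_goals simp [Frame.pass, ArithOp.apply, h1, h2, h3, h4]
  | succ j ih =>
    obtain ⟨c₁, hc₁, d₁, hd₁⟩ := ih (k + 1) (M * 64) (by rwa [show k + 1 + j = k + (j + 1) by ring])
      fun i hi => by
        have := hj' (i + 1) (by omega)
        rwa [show k + 1 + i = k + (i + 1) by ring]
    have hN : (m + 1) * (M * 64 ^ (j + 1) * T) = (m + 1) * (M * 64 * 64 ^ j * T) := by ring
    rw [hN, show k + (j + 1) = k + 1 + j by ring]
    refine ⟨⟨0, 0, 1⟩ + (⟨0, 0, 1⟩ + (⟨0, 0, 1⟩ + (⟨0, 0, 1⟩ + (c₁ + 0)))), ?_, d₁ + 1,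
      fun d hd s h0 h1 h2 h3 h4 => ?_⟩
    · simp only [Usage.size_add, Usage.size_mk, Usage.size_zero]
      omega
    obtain ⟨d, rfl⟩ := Nat.exists_eq_add_of_le' (le_trans (Nat.le_add_left 1 _) hd)
    rw [← Measure.bind_dirac (m := (estLaw g B _ _ 0 0).bind _)]
    refine yields_lit (yields_arith (yields_branch_no ?_ (yields_lit (yields_arith (yields_lit
      (yields_arith (yields_call Measure.measurable_dirac (hd₁ d (by omega) _ ?_ ?_ ?_ ?_ ?_)
        (fun x => yields_ret ?_) (measurable_exec_run hg _ _ _))))))))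
    · simpa [h0, h3, ArithOp.apply] using hj' 0 (by omega)
    all_goals simp [Frame.pass, ArithOp.apply, h0, h1, h2, h3, h4]

theorem runOn_algorithm {g : Payouts T D} (hg : ∀ i, Measurable (g i)) (B : Simulator T D)
    [∀ t, IsMarkovKernel (B t)] {ε δ : ℝ} {m K : ℕ} (hm : 1 ≤ δ * 2 ^ m)
    (hm' : ∀ i < m, δ * 2 ^ i < 1) (hK : 2 ≤ ε * K) (hK' : ∀ i < K, ε * i < 2) :
    ∃ c : Usage,
      c.size ≤ 4 * K + 3 * m + 5 + estCost T ((m + 1) * (64 ^ K * T)) K ∧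
      ∃ d, runOn algorithm g B ε δ d =
        (estLaw g B ((m + 1) * (64 ^ K * T)) K 0 0).map fun x => (0 - x, c) := by
  obtain ⟨c₁, hc₁, d₁, hd₁⟩ := levelCode_spec hg B hm hm' K 0 1 (by simpa using hK)
    (by simpa using hK')
  simp only [one_mul, zero_add] at hc₁ hd₁
  refine ⟨c₁, hc₁, d₁ + 1, ?_⟩
  have h : Yields (run algorithm g B (d₁ + 1) 0
      (fun n => [ε, δ, (T : ℝ)].getD n 0, (0 : ℕ → SamplePath T D)))
      (((estLaw g B ((m + 1) * (64 ^ K * T)) K 0 0).bind fun x => Measure.dirac (0 - x)).bind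
        fun x => Measure.dirac x) (c₁ + 0) := by
    refine yields_lit (yields_lit (yields_call Measure.measurable_dirac
      (hd₁ d₁ le_rfl _ ?_ ?_ ?_ ?_ ?_) (fun x => yields_ret ?_) (measurable_exec_run hg _ _ _)))
    all_goals simp [Frame.pass]
  have h' := h ⟨0, 0, 0⟩
  have hc : (⟨0, 0, 0⟩ : Usage) + (c₁ + 0) = c₁ := by
    change Usage.mk _ _ _ = _
    cases c₁
    congr 1 <;> exact Nat.zero_add _
  rw [Measure.bind_dirac, Measure.bind_dirac_eq_map _ (by fun_prop), hc,
    Measure.map_map (by fun_prop) (by fun_prop)] at h'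
  exact h'

end Search

/-! ### Value functions -/

/-- The minimum of `v 1, …, v i`, clipped to the unit interval. -/
noncomputable def clippedMin (v : ℕ → ℝ) : ℕ → ℝ
  | 0 => 1
  | i + 1 => min (max (v (i + 1)) 0) (clippedMin v i)

/-- The value function of level `k` at time `n`, along a path. -/
noncomputable def value {T D : ℕ} (g : Payouts T D) (B : Simulator T D) :
    ℕ → ℕ → SamplePath T D → ℝ
  | 0, n, y => evalPayout g n y
  | k + 1, n, y => value g B k n y -
      ∫ z, clippedMin (fun i => value g B k i z) T ∂simulate B n y

theorem clippedMin_nonneg (v : ℕ → ℝ) (i : ℕ) : 0 ≤ clippedMin v i := by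
  induction i with
  | zero => exact zero_le_one
  | succ i ih => exact le_min (le_max_right _ _) ih

theorem clippedMin_le_one (v : ℕ → ℝ) (i : ℕ) : clippedMin v i ≤ 1 := by
  induction i with
  | zero => exact le_rfl
  | succ i ih => exact (min_le_right _ _).trans ih

theorem clippedMin_mem (v : ℕ → ℝ) (i : ℕ) : clippedMin v i ∈ Set.Icc (0 : ℝ) 1 :=
  ⟨clippedMin_nonneg v i, clippedMin_le_one v i⟩

theorem measurable_clippedMin {α : Type*} [MeasurableSpace α] {v : ℕ → α → ℝ}
    (hv : ∀ i, Measurable (v i)) (i : ℕ) : Measurable fun a => clippedMin (fun j => v j a) i := by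
  induction i with
  | zero => exact measurable_const
  | succ i ih => exact ((hv _).max measurable_const).min ih

theorem measurable_value {T D : ℕ} {g : Payouts T D} (hg : ∀ i, Measurable (g i))
    (B : Simulator T D) [∀ t, IsMarkovKernel (B t)] (k n : ℕ) : Measurable (value g B k n) := by
  induction k generalizing n with
  | zero => exact measurable_evalPayout hg n
  | succ k ih =>
    let κ : Kernel (SamplePath T D) (SamplePath T D) := ⟨simulate B n, measurable_simulate B n⟩
    have : IsMarkovKernel κ := ⟨fun y => isProbabilityMeasure_simulate n y⟩
    have h := (measurable_clippedMin ih T).stronglyMeasurable.integral_kernel (κ := κ)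
    exact (ih n).sub h.measurable

/-! ### Accuracy of the estimates -/

section Bind

variable {α β : Type*} [MeasurableSpace α] [MeasurableSpace β]

/-- Union bound for a two-stage experiment: either the first stage is bad, or the second fails given
a good first stage. -/
theorem bind_apply_le {μ : Measure α} [IsProbabilityMeasure μ] {η : α → Measure β}
    (hη : Measurable η) (hη' : ∀ a, IsProbabilityMeasure (η a)) {s : Set β} (hs : MeasurableSet s)
    {bad : Set α} (hbad : MeasurableSet bad) {p q : ℝ≥0∞} (hp : μ bad ≤ p)
    (hq : ∀ a ∉ bad, η a s ≤ q) : (μ.bind η) s ≤ p + q := by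
  rw [Measure.bind_apply hs hη.aemeasurable]
  calc ∫⁻ a, η a s ∂μ ≤ ∫⁻ a, (bad.indicator (fun _ => 1) a + q) ∂μ := by
        refine lintegral_mono fun a => ?_
        by_cases ha : a ∈ bad
        · simp only [ha, Set.indicator_of_mem]
          exact prob_le_one.trans le_self_add
        · simpa [ha] using hq a ha
    _ = μ bad + q := by
        rw [lintegral_add_right _ measurable_const, lintegral_indicator hbad]
        simp
    _ ≤ p + q := by gcongr

theorem bind_dirac_apply_le {μ : Measure α} [IsProbabilityMeasure μ] {f : α → β}
    (hf : Measurable f) {s : Set β} (hs : MeasurableSet s) {bad : Set α} (hbad : MeasurableSet bad)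
    {p : ℝ≥0∞} (hp : μ bad ≤ p) (h : ∀ a ∉ bad, f a ∉ s) :
    (μ.bind fun a => Measure.dirac (f a)) s ≤ p := by
  have h1 := bind_apply_le (Measure.measurable_dirac.comp hf)
    (fun a => Measure.dirac.isProbabilityMeasure (x := f a)) hs hbad hp (q := 0) fun a ha => by
      simp [Measure.dirac_apply' _ hs, h a ha]
  rwa [add_zero] at h1

theorem integral_bind {μ : Measure α} [IsProbabilityMeasure μ] {η : α → Measure β}
    (hη : Measurable η) (hη' : ∀ a, IsProbabilityMeasure (η a)) {f : β → ℝ}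
    (hf : Integrable f (μ.bind η)) : ∫ x, f x ∂μ.bind η = ∫ a, ∫ x, f x ∂η a ∂μ := by
  let κ : Kernel α β := ⟨η, hη⟩
  have : IsMarkovKernel κ := ⟨hη'⟩
  have h : (κ ∘ₖ Kernel.const Unit μ) () = μ.bind η := by
    rw [Kernel.comp_apply, Kernel.const_apply]
    rfl
  rw [← h] at hf ⊢
  rw [Kernel.integral_comp hf, Kernel.const_apply]
  rfl

end Bind

theorem minLaw_compl_Icc {est : ℕ → Measure ℝ} (h : ∀ i, IsProbabilityMeasure (est i)) (i : ℕ) :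
    minLaw est i (Set.Icc 0 1)ᶜ = 0 := by
  induction i with
  | zero => simp [minLaw]
  | succ i ih =>
    have := isProbabilityMeasure_minLaw h i
    rw [← nonpos_iff_eq_zero, ← add_zero (0 : ℝ≥0∞)]
    refine bind_apply_le (measurable_bind_dirac _ (f := fun p => min (max p.1 0) p.2)
      (by fun_prop)) (fun x => isProbabilityMeasure_bind_dirac _ (by fun_prop))
      measurableSet_Icc.compl MeasurableSet.empty (by simp) fun x _ => ?_
    refine bind_dirac_apply_le (by fun_prop) measurableSet_Icc.compl measurableSet_Icc.compl ih.le
      fun r hr => ?_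
    rw [Set.notMem_compl_iff] at hr ⊢
    exact ⟨le_min (le_max_right _ _) hr.1, (min_le_right _ _).trans hr.2⟩

theorem measurableSet_lt_abs_sub (e v : ℝ) : MeasurableSet {x : ℝ | e < |x - v|} :=
  measurableSet_lt measurable_const (by fun_prop)

/-- Minimum and clipping are 1-Lipschitz in the supremum distance, so errors do not accumulate; only
failure probabilities add up. -/
theorem minLaw_accuracy {est : ℕ → Measure ℝ} (h : ∀ i, IsProbabilityMeasure (est i))
    {v : ℕ → ℝ} {e : ℝ} (he : 0 ≤ e) {p : ℝ≥0∞} (hp : ∀ i, est i {x | e < |x - v i|} ≤ p) (i : ℕ) :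
    minLaw est i {r | e < |r - clippedMin v i|} ≤ i * p := by
  induction i with
  | zero => simp [minLaw, clippedMin, he]
  | succ i ih =>
    have := isProbabilityMeasure_minLaw h i
    have hsplit : ((i + 1 : ℕ) : ℝ≥0∞) * p = p + i * p := by push_cast; ring
    rw [hsplit]
    refine bind_apply_le (measurable_bind_dirac _ (f := fun p => min (max p.1 0) p.2)
      (by fun_prop)) (fun x => isProbabilityMeasure_bind_dirac _ (by fun_prop))
      (measurableSet_lt_abs_sub _ _) (measurableSet_lt_abs_sub _ _) (hp (i + 1)) fun x hx => ?_
    refine bind_dirac_apply_le (by fun_prop)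
      (measurableSet_lt_abs_sub _ _) (measurableSet_lt_abs_sub _ _) ih fun r hr => ?_
    simp only [Set.mem_ofPred_eq, not_lt] at hx hr ⊢
    exact (abs_min_sub_min_le_max _ _ _ _).trans
      (max_le ((abs_max_sub_max_le_abs _ _ _).trans hx) hr)

/-- On the failure event both quantities lie in [0,1], so failure contributes at most its
probability to the bias. -/
theorem integral_minLaw_accuracy {est : ℕ → Measure ℝ} (h : ∀ i, IsProbabilityMeasure (est i))
    {v : ℕ → ℝ} {e p : ℝ} (he : 0 ≤ e) (hp0 : 0 ≤ p)
    (hp : ∀ i, est i {x | e < |x - v i|} ≤ ENNReal.ofReal p) (i : ℕ) :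
    |∫ r, r ∂minLaw est i - clippedMin v i| ≤ e + i * p := by
  have := isProbabilityMeasure_minLaw h i
  have hae : ∀ᵐ r ∂minLaw est i, r ∈ Set.Icc (0 : ℝ) 1 := minLaw_compl_Icc h i
  have hint : Integrable (fun r : ℝ => r) (minLaw est i) :=
    Integrable.of_mem_Icc 0 1 aemeasurable_id hae
  set bad : Set ℝ := {r | e < |r - clippedMin v i|}
  have hbad : MeasurableSet bad := measurableSet_lt_abs_sub _ _
  have hbound : (minLaw est i).real bad ≤ i * p := by
    refine ENNReal.toReal_le_of_le_ofReal (by positivity)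
      ((minLaw_accuracy h he hp i).trans_eq ?_)
    rw [ENNReal.ofReal_mul (Nat.cast_nonneg _), ENNReal.ofReal_natCast]
  calc |∫ r, r ∂minLaw est i - clippedMin v i|
      = |∫ r, (r - clippedMin v i) ∂minLaw est i| := by
        rw [integral_sub hint (integrable_const _)]
        simp
    _ ≤ ∫ r, |r - clippedMin v i| ∂minLaw est i := abs_integral_le_integral_abs
    _ ≤ ∫ r, (e + bad.indicator (fun _ => 1) r) ∂minLaw est i := by
        refine integral_mono_ae (hint.sub (integrable_const _)).abs
          ((integrable_const _).add ((integrable_const _).indicator hbad)) ?_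
        filter_upwards [hae] with r hr
        by_cases hb : r ∈ bad
        · have h1 := clippedMin_mem v i
          have h2 : |r - clippedMin v i| ≤ 1 := abs_le.2 ⟨by linarith [hr.1, h1.2],
            by linarith [hr.2, h1.1]⟩
          simp only [hb, Set.indicator_of_mem]
          linarith
        · simpa [hb] using not_lt.1 hb
    _ = e + (minLaw est i).real bad := by
        rw [integral_add (integrable_const _) ((integrable_const _).indicator hbad),
          integral_indicator hbad]
        simp
    _ ≤ e + i * p := by gcongr

/-! ### Hoeffding bound for the sample mean -/

theorem sumLaw_succ (μ : Measure ℝ) [IsProbabilityMeasure μ] (c : ℕ) :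
    sumLaw μ (c + 1) = (μ.prod (sumLaw μ c)).map fun p => p.1 + p.2 := by
  have := isProbabilityMeasure_sumLaw (μ := μ) c
  have hadd : Measurable fun p : ℝ × ℝ => p.1 + p.2 := by fun_prop
  ext s hs
  rw [Measure.map_apply hadd hs, Measure.prod_apply (hadd hs), sumLaw,
    Measure.bind_apply hs
      (measurable_bind_dirac _ (f := fun p => p.1 + p.2) (by fun_prop)).aemeasurable]
  refine lintegral_congr fun x => ?_
  rw [Measure.bind_dirac_eq_map _ (by fun_prop), Measure.map_apply (by fun_prop) hs]
  rfl

/-- Hoeffding's lemma gives variance proxy 1/4 on the unit interval, and proxies of independent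
summands add; the product form in `sumLaw_succ` supplies independence. -/
theorem hasSubgaussianMGF_sumLaw {μ : Measure ℝ} [IsProbabilityMeasure μ]
    (hμ : ∀ᵐ x ∂μ, x ∈ Set.Icc (0 : ℝ) 1) (c : ℕ) :
    HasSubgaussianMGF (fun a => a - c * ∫ x, x ∂μ) (c * (1 / 4)) (sumLaw μ c) := by
  induction c with
  | zero =>
    have h : HasSubgaussianMGF (fun _ : ℝ => (0 : ℝ)) 0 (sumLaw μ 0) := by
      have := isProbabilityMeasure_sumLaw (μ := μ) 0
      exact HasSubgaussianMGF.fun_zero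
    simp only [Nat.cast_zero, zero_mul]
    refine h.congr ?_
    rw [sumLaw]
    exact (ae_dirac_iff (measurableSet_eq_fun (by fun_prop) (by fun_prop))).2 (by simp)
  | succ c ih =>
    have := isProbabilityMeasure_sumLaw (μ := μ) c
    have h1 := hasSubgaussianMGF_of_mem_Icc (X := fun x : ℝ => x) aemeasurable_id hμ
    have hq : (‖(1 : ℝ) - 0‖₊ / 2) ^ 2 = (1 / 4 : ℝ≥0) := by
      rw [sub_zero, nnnorm_one]
      norm_num
    rw [hq] at h1
    have h1' : HasSubgaussianMGF (fun p : ℝ × ℝ => p.1 - ∫ x, x ∂μ) (1 / 4)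
        (μ.prod (sumLaw μ c)) :=
      HasSubgaussianMGF.of_map (X := fun x : ℝ => x - ∫ x, x ∂μ) (Y := Prod.fst) (by fun_prop)
        (by rw [Measure.map_fst_prod]; simpa using h1)
    have h2' : HasSubgaussianMGF (fun p : ℝ × ℝ => p.2 - c * ∫ x, x ∂μ) (c * (1 / 4))
        (μ.prod (sumLaw μ c)) :=
      HasSubgaussianMGF.of_map (X := fun x : ℝ => x - c * ∫ x, x ∂μ) (Y := Prod.snd) (by fun_prop)
        (by rw [Measure.map_snd_prod]; simpa using ih)
    have h3 := h1'.add_of_indepFun h2' (indepFun_prod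
      (X := fun x : ℝ => x - ∫ x, x ∂μ) (Y := fun x : ℝ => x - c * ∫ x, x ∂μ)
      (by fun_prop) (by fun_prop))
    rw [sumLaw_succ]
    have h4 : HasSubgaussianMGF id ((c + 1 : ℕ) * (1 / 4))
        (((μ.prod (sumLaw μ c)).map fun p => p.1 + p.2).map
          fun a => a - (c + 1 : ℕ) * ∫ x, x ∂μ) := by
      rw [Measure.map_map (by fun_prop) (by fun_prop), HasSubgaussianMGF.id_map_iff (by fun_prop)]
      convert h3 using 1
      · ext p
        simp only [Function.comp_apply]
        push_cast
        ring
      · push_cast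
        ring
    rwa [HasSubgaussianMGF.id_map_iff (by fun_prop)] at h4

theorem sumLaw_concentration {μ : Measure ℝ} [IsProbabilityMeasure μ]
    (hμ : ∀ᵐ x ∂μ, x ∈ Set.Icc (0 : ℝ) 1) {c : ℕ} (hc : 0 < c) {s : ℝ} (hs : 0 ≤ s) :
    sumLaw μ c {a | s < |a / c - ∫ x, x ∂μ|} ≤
      ENNReal.ofReal (2 * Real.exp (-(2 * c * s ^ 2))) := by
  have := isProbabilityMeasure_sumLaw (μ := μ) c
  have h := hasSubgaussianMGF_sumLaw hμ c
  have hc' : (0 : ℝ) < c := Nat.cast_pos.2 hc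
  have h1 := h.measure_ge_le (ε := s * c) (by positivity)
  have h2 := h.neg.measure_ge_le (ε := s * c) (by positivity)
  have he : -(s * c) ^ 2 / (2 * ((c * (1 / 4) : ℝ≥0) : ℝ)) = -(2 * c * s ^ 2) := by
    push_cast
    field_simp
    norm_num
  rw [he] at h1 h2
  have hsub : {a : ℝ | s < |a / c - ∫ x, x ∂μ|} ⊆
      {a | s * c ≤ a - c * ∫ x, x ∂μ} ∪ {a | s * c ≤ (-fun a => a - c * ∫ x, x ∂μ) a} := by
    intro a ha
    have e1 : a - c * ∫ x, x ∂μ = (a / c - ∫ x, x ∂μ) * c := by field_simp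
    simp only [Set.mem_union, Set.mem_ofPred_eq, Pi.neg_apply, e1]
    have ha : s < |a / c - ∫ x, x ∂μ| := ha
    rcases lt_abs.1 ha with ha | ha
    · left
      gcongr
    · right
      rw [← neg_mul]
      gcongr
  have h3 : (sumLaw μ c).real {a | s < |a / c - ∫ x, x ∂μ|} ≤ 2 * Real.exp (-(2 * c * s ^ 2)) := by
    refine (measureReal_mono hsub).trans ((measureReal_union_le _ _).trans ?_)
    linarith
  rw [← ENNReal.ofReal_toReal (measure_ne_top (sumLaw μ c) _)]
  exact ENNReal.ofReal_le_ofReal h3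

/-- The error obeys e ↦ 2e + r with r = TKq + s: one e from the level-k estimate, another from the
inner minima, TKq for their bias on failure, s for sampling. Each level adds one Hoeffding failure
q. -/
theorem estLaw_accuracy {T D : ℕ} {g : Payouts T D} (hg : ∀ i, Measurable (g i))
    (B : Simulator T D) [∀ t, IsMarkovKernel (B t)] {N : ℕ} (hN : 0 < N) {s q : ℝ} (hs : 0 ≤ s)
    (hq : 2 * Real.exp (-(2 * N * s ^ 2)) ≤ q) (K : ℕ) {k : ℕ} (hk : k ≤ K) (n : ℕ)
    (y : SamplePath T D) :
    estLaw g B N k n y {x | (2 ^ k - 1) * (T * (K * q) + s) < |x - value g B k n y|} ≤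
      ENNReal.ofReal (k * q) := by
  have hq0 : 0 ≤ q := le_trans (by positivity) hq
  induction k generalizing n y with
  | zero => simp [estLaw, value]
  | succ k ih =>
    obtain ⟨hprob, hmeas⟩ := estLaw_spec hg B N k
    set r : ℝ := T * (K * q) + s with hr
    set e : ℝ := (2 ^ k - 1) * r with he
    have hr0 : 0 ≤ r := by positivity
    have he0 : 0 ≤ e := mul_nonneg (sub_nonneg.2 (one_le_pow₀ one_le_two)) hr0
    have hmin : Measurable fun z : SamplePath T D => minLaw (fun i => estLaw g B N k i z) T :=
      measurable_minLaw (fun a i => hprob i a) hmeas T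
    have hmin' : ∀ z, IsProbabilityMeasure (minLaw (fun i => estLaw g B N k i z) T) :=
      fun z => isProbabilityMeasure_minLaw (fun i => hprob i z) T
    set H := (simulate B n y).bind fun z => minLaw (fun i => estLaw g B N k i z) T with hH
    have hHprob : IsProbabilityMeasure H := isProbabilityMeasure_bind hmin hmin'
    have hHmem : ∀ᵐ x ∂H, x ∈ Set.Icc (0 : ℝ) 1 := by
      change H (Set.Icc 0 1)ᶜ = 0
      rw [hH, Measure.bind_apply measurableSet_Icc.compl hmin.aemeasurable]
      simp [minLaw_compl_Icc (fun i => hprob i _)]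
    have hHint : Integrable (fun x : ℝ => x) H := Integrable.of_mem_Icc 0 1 aemeasurable_id hHmem
    have hmean : |∫ x, x ∂H - ∫ z, clippedMin (fun i => value g B k i z) T ∂simulate B n y| ≤
        e + T * (k * q) := by
      have hc : Integrable (fun z => clippedMin (fun i => value g B k i z) T) (simulate B n y) :=
        Integrable.of_mem_Icc 0 1 (measurable_clippedMin (measurable_value hg B k) T).aemeasurable
          (ae_of_all _ fun z => clippedMin_mem _ _)
      have hb : ∀ z, |∫ x, x ∂minLaw (fun i => estLaw g B N k i z) T -
          clippedMin (fun i => value g B k i z) T| ≤ e + T * (k * q) := fun z =>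
        integral_minLaw_accuracy (fun i => hprob i z) he0 (by positivity)
          (fun i => ih (by omega) i z) T
      have hm : Integrable (fun z => ∫ x, x ∂minLaw (fun i => estLaw g B N k i z) T)
          (simulate B n y) := by
        let κ : Kernel (SamplePath T D) ℝ := ⟨_, hmin⟩
        have : IsMarkovKernel κ := ⟨hmin'⟩
        have h := (stronglyMeasurable_id (α := ℝ)).integral_kernel (κ := κ)
        refine Integrable.of_mem_Icc 0 1 h.measurable.aemeasurable (ae_of_all _ fun z => ?_)
        have hae : ∀ᵐ r ∂minLaw (fun i => estLaw g B N k i z) T, r ∈ Set.Icc (0 : ℝ) 1 :=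
          minLaw_compl_Icc (fun i => hprob i z) T
        have hi : Integrable (fun r : ℝ => r) (minLaw (fun i => estLaw g B N k i z) T) :=
          Integrable.of_mem_Icc 0 1 aemeasurable_id hae
        constructor
        · exact integral_nonneg_of_ae (hae.mono fun r hr => hr.1)
        · have := integral_mono_ae hi (integrable_const (1 : ℝ)) (hae.mono fun r hr => hr.2)
          simpa using this
      rw [hH, integral_bind hmin hmin' hHint, ← integral_sub hm hc]
      refine abs_integral_le_integral_abs.trans ?_
      have := integral_mono_ae (hm.sub hc).abs (integrable_const (e + T * (k * q)))
        (ae_of_all _ hb)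
      simpa using this
    have hsum := isProbabilityMeasure_sumLaw (μ := H) N
    have hsplit : ENNReal.ofReal ((k + 1 : ℕ) * q) = ENNReal.ofReal (k * q) + ENNReal.ofReal q := by
      rw [← ENNReal.ofReal_add (by positivity) hq0]
      congr 1
      push_cast
      ring
    rw [hsplit]
    refine bind_apply_le (measurable_bind_dirac _ (f := fun p => p.1 - p.2 / N) (by fun_prop))
      (fun x => isProbabilityMeasure_bind_dirac _ (by fun_prop)) (measurableSet_lt_abs_sub _ _)
      (measurableSet_lt_abs_sub _ _) (ih (by omega) n y) fun x hx => ?_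
    refine bind_dirac_apply_le (by fun_prop)
      (measurableSet_lt_abs_sub _ _) (bad := {a : ℝ | s < |a / N - ∫ x, x ∂H|})
      (measurableSet_lt measurable_const (by fun_prop))
      ((sumLaw_concentration hHmem hN hs).trans (ENNReal.ofReal_le_ofReal hq)) fun a ha => ?_
    simp only [Set.mem_ofPred_eq, not_lt] at hx ha ⊢
    -- Replacing k by K makes the increment r the same at all levels, so the recursion solves to
    -- (2^k - 1) r.
    have hkK : T * ((k : ℝ) * q) ≤ T * (K * q) := by
      have : (k : ℝ) ≤ K := by exact_mod_cast (by omega : k ≤ K)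
      gcongr
    have e1 : (2 ^ (k + 1) - 1) * r = 2 * e + r := by rw [he]; ring
    rw [e1, value]
    rw [abs_le] at *
    constructor <;> linarith [hmean.1, hmean.2, hx.1, hx.2, ha.1, ha.2]

/-! ### Value functions along the process -/

theorem value_succ_le {T D : ℕ} (g : Payouts T D) (B : Simulator T D) (k n : ℕ)
    (y : SamplePath T D) : value g B (k + 1) n y ≤ value g B k n y := by
  rw [value]
  have h : 0 ≤ ∫ z, clippedMin (fun i => value g B k i z) T ∂simulate B n y :=
    integral_nonneg fun z => clippedMin_nonneg _ T
  linarith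

theorem clippedMin_mono {v w : ℕ → ℝ} (h : ∀ i, v i ≤ w i) (i : ℕ) :
    clippedMin v i ≤ clippedMin w i := by
  induction i with
  | zero => exact le_rfl
  | succ i ih => exact min_le_min (max_le_max (h _) le_rfl) ih

theorem clippedMin_le {v : ℕ → ℝ} {i n : ℕ} (hi : 1 ≤ i) (hin : i ≤ n) :
    clippedMin v n ≤ max (v i) 0 := by
  induction n with
  | zero => omega
  | succ n ih =>
    rcases Nat.lt_or_ge n i with h | h
    · obtain rfl : i = n + 1 := by omega
      exact min_le_left _ _
    · exact (min_le_right _ _).trans (ih h)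

theorem exists_le_of_clippedMin_le {v : ℕ → ℝ} {c : ℝ} (hc : c < 1) {n : ℕ}
    (h : clippedMin v n ≤ c) : ∃ i, 1 ≤ i ∧ i ≤ n ∧ v i ≤ c := by
  induction n with
  | zero => exact absurd h hc.not_ge
  | succ n ih =>
    rcases min_le_iff.1 h with h | h
    · exact ⟨n + 1, by omega, le_rfl, (le_max_left _ _).trans h⟩
    · obtain ⟨i, h1, h2, h3⟩ := ih h
      exact ⟨i, h1, by omega, h3⟩

/-! ### Dependence on the past only -/

section Past

variable {T D : ℕ}

/-- The columns of a path up to time `n`. -/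
abbrev past (n : ℕ) (y : SamplePath T D) : Hist D (min n T) :=
  y.take (min n T) (Nat.min_le_right n T)

theorem past_apply_eq {n : ℕ} {y z : SamplePath T D} (h : past n y = past n z) (j : Fin T)
    (hj : j.1 < n) : y j = z j :=
  congrFun h ⟨j, lt_min hj j.2⟩

theorem past_eq_of_forall {n : ℕ} {y z : SamplePath T D} (h : ∀ j : Fin T, j.1 < n → y j = z j) :
    past n y = past n z :=
  funext fun j => h _ (lt_of_lt_of_le j.2 (Nat.min_le_left _ _))

theorem simulate_congr (B : Simulator T D) {n : ℕ} {y z : SamplePath T D}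
    (h : past n y = past n z) : simulate B n y = simulate B n z :=
  congrArg (B ⟨min n T, by omega⟩) h

/-- Valid for every path, not just almost surely: both the payout and the simulator are given only
the columns up to time n. -/
theorem value_congr (g : Payouts T D) (B : Simulator T D) (k : ℕ) {n : ℕ} {y z : SamplePath T D}
    (h : past n y = past n z) : value g B k n y = value g B k n z := by
  induction k with
  | zero =>
    simp only [value, evalPayout]
    split_ifs with hn
    · refine congrArg (g _) (funext fun i => past_apply_eq h _ ?_)
      have hi : i.1 < n - 1 + 1 := i.2
      simp only [Fin.val_castLE]
      omega
    · rfl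
  | succ k ih => rw [value, value, ih, simulate_congr B h]

end Past

/-! ### Conditioning on the past -/

section AlongProcess

variable {T D : ℕ} {Ω : Type*} [MeasurableSpace Ω] {P : Measure Ω} [IsProbabilityMeasure P]
  {Y : Ω → SamplePath T D} {g : Payouts T D} {B : Simulator T D} [∀ t, IsMarkovKernel (B t)]

/-- Disintegrate the joint law of past and path: almost sure properties of Y pass to the resampled
path, including the property of extending the given past. -/
theorem ae_simulate (hB : IsBaseSimulator P Y B) (n : ℕ) {p : SamplePath T D → Prop}
    (hp : MeasurableSet {y | p y}) (h : ∀ᵐ ω ∂P, p (Y ω)) :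
    ∀ᵐ ω ∂P, ∀ᵐ z ∂simulate B n (Y ω), p z ∧ past n z = past n (Y ω) := by
  have hlaw := hB ⟨min n T, by omega⟩
  have hX := hlaw.aemeasurable_fst
  have hq : MeasurableSet {q : Hist D (min n T) × SamplePath T D | p q.2 ∧ past n q.2 = q.1} :=
    (measurable_snd hp).inter
      (measurableSet_eq_fun ((measurable_take _ _).comp measurable_snd) measurable_fst)
  have h1 : ∀ᵐ q ∂(P.map fun ω => (past n (Y ω), Y ω)), p q.2 ∧ past n q.2 = q.1 :=
    (ae_map_iff hlaw.aemeasurable hq).2 (h.mono fun ω hω => ⟨hω, rfl⟩)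
  have h2 : (P.map fun ω => (past n (Y ω), Y ω)) =
    (P.map fun ω => past n (Y ω)) ⊗ₘ B ⟨min n T, by omega⟩ := hlaw.map_eq
  rw [h2] at h1
  exact ae_of_ae_map hX (Measure.ae_ae_of_ae_compProd h1)

/-- The defining property of conditional expectation, tested on events of the past. -/
theorem setIntegral_simulate (hB : IsBaseSimulator P Y B) (n : ℕ) {f : SamplePath T D → ℝ}
    (hf : Measurable f) (hf' : ∀ y, f y ∈ Set.Icc (0 : ℝ) 1) {s : Set (Hist D (min n T))}
    (hs : MeasurableSet s) :
    ∫ ω in (fun ω => past n (Y ω)) ⁻¹' s, (∫ z, f z ∂simulate B n (Y ω)) ∂P =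
      ∫ ω in (fun ω => past n (Y ω)) ⁻¹' s, f (Y ω) ∂P := by
  have hlaw := hB ⟨min n T, by omega⟩
  have hX : AEMeasurable (fun ω => past n (Y ω)) P := hlaw.aemeasurable_fst
  have h2 : (P.map fun ω => (past n (Y ω), Y ω)) =
    (P.map fun ω => past n (Y ω)) ⊗ₘ B ⟨min n T, by omega⟩ := hlaw.map_eq
  have hprob : IsProbabilityMeasure (P.map fun ω => past n (Y ω)) :=
    Measure.isProbabilityMeasure_map hX
  have h3 := Measure.setIntegral_compProd (μ := P.map fun ω => past n (Y ω))
    (κ := B ⟨min n T, by omega⟩) hs MeasurableSet.univ (f := fun q => f q.2)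
    (Integrable.of_mem_Icc 0 1 (hf.comp measurable_snd).aemeasurable
      (ae_of_all _ fun q => hf' q.2)).integrableOn
  have hm : StronglyMeasurable fun x => ∫ z, f z ∂B ⟨min n T, by omega⟩ x :=
    hf.stronglyMeasurable.integral_kernel
  have h4 := setIntegral_map (μ := P) (g := fun ω => (past n (Y ω), Y ω)) (f := fun q => f q.2)
    (hs.prod .univ) (hf.comp measurable_snd).aestronglyMeasurable hlaw.aemeasurable
  have h5 := setIntegral_map hs hm.aestronglyMeasurable hX
  simp only [Measure.restrict_univ] at h3
  rw [Set.mk_preimage_prod, Set.preimage_univ, Set.inter_univ] at h4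
  have h6 := congrArg (fun μ => ∫ q in s ×ˢ Set.univ, f q.2 ∂μ) h2
  exact h5.symm.trans (h3.symm.trans (h6.symm.trans h4))

/-- The value functions along the process are nonnegative. -/
theorem ae_value_nonneg (hg : ∀ i, Measurable (g i)) (hB : IsBaseSimulator P Y B)
    (h01 : ∀ᵐ ω ∂P, ∀ i, payout g i (Y ω) ∈ Set.Icc (0 : ℝ) 1) (k : ℕ) :
    ∀ᵐ ω ∂P, ∀ i : Fin T, 0 ≤ value g B k (i + 1) (Y ω) := by
  induction k with
  | zero =>
    filter_upwards [h01] with ω hω i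
    have hi : 0 < i.1 + 1 ∧ i.1 + 1 ≤ T := ⟨by omega, i.2⟩
    simpa [value, evalPayout, hi] using (hω i).1
  | succ k ih =>
    rw [ae_all_iff] at ih ⊢
    intro i
    have hp : MeasurableSet {y : SamplePath T D | 0 ≤ value g B k (i + 1) y} :=
      measurableSet_le measurable_const (measurable_value hg B k _)
    filter_upwards [ih i, ae_simulate hB (i + 1) hp (ih i)] with ω hω hz
    rw [value, sub_nonneg]
    -- The minimum is at most the value at time i + 1, which is constant under resampling of the
    -- future.
    have h1 := integral_mono_ae (Integrable.of_mem_Icc 0 1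
      (measurable_clippedMin (measurable_value hg B k) T).aemeasurable
      (ae_of_all _ fun z => clippedMin_mem (fun i => value g B k i z) T))
      (integrable_const (value g B k (i + 1) (Y ω))) (μ := simulate B (i + 1) (Y ω)) (by
        filter_upwards [hz] with z hz
        rw [← value_congr g B k hz.2]
        exact (clippedMin_le (by omega) i.2).trans (max_le le_rfl hz.1))
    simpa using h1

/-- Given the whole path, the simulator returns that path, so conditional expectations at time T
drop out. -/
theorem ae_value_last (g : Payouts T D) (hB : IsBaseSimulator P Y B)
    (k : ℕ) : ∀ᵐ ω ∂P, value g B k T (Y ω) = evalPayout g T (Y ω) -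
      ∑ j ∈ Finset.range k, clippedMin (fun i => value g B j i (Y ω)) T := by
  induction k with
  | zero => simp [value]
  | succ k ih =>
    filter_upwards [ih, ae_simulate hB T (p := fun _ => True) MeasurableSet.univ
      (ae_of_all _ fun _ => trivial)] with ω hω hz
    have h1 : ∫ z, clippedMin (fun i => value g B k i z) T ∂simulate B T (Y ω) =
        ∫ _, clippedMin (fun i => value g B k i (Y ω)) T ∂simulate B T (Y ω) := by
      refine integral_congr_ae (hz.mono fun z hz => ?_)
      have : z = Y ω := funext fun j => past_apply_eq hz.2 j j.2
      simp only [this]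
    rw [value, h1, hω, Finset.sum_range_succ]
    simp
    ring

/-- The terminal payout is at most 1 and pays for k + 1 minima, of which the last is smallest, while
the terminal value stays nonnegative. -/
theorem ae_clippedMin_le (hT : 1 ≤ T) (hg : ∀ i, Measurable (g i)) (hB : IsBaseSimulator P Y B)
    (h01 : ∀ᵐ ω ∂P, ∀ i, payout g i (Y ω) ∈ Set.Icc (0 : ℝ) 1) (k : ℕ) :
    ∀ᵐ ω ∂P, clippedMin (fun i => value g B k i (Y ω)) T ≤ 1 / (k + 1) := by
  filter_upwards [h01, ae_value_nonneg hg hB h01 (k + 1), ae_value_last g hB (k + 1)]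
    with ω h1 h2 h3
  have h4 := h2 ⟨T - 1, by omega⟩
  have hT' : T - 1 + 1 = T := by omega
  simp only [hT'] at h4
  have h5 : evalPayout g T (Y ω) ≤ 1 := by
    have hi : 0 < T ∧ T ≤ T := ⟨by omega, le_rfl⟩
    rw [evalPayout, dif_pos hi]
    exact (h1 _).2
  have hanti : Antitone fun j => clippedMin (fun i => value g B j i (Y ω)) T :=
    antitone_nat_of_succ_le fun j => clippedMin_mono (fun i => value_succ_le g B j i _) T
  have h6 : ((k + 1 : ℕ) : ℝ) * clippedMin (fun i => value g B k i (Y ω)) T ≤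
      ∑ j ∈ Finset.range (k + 1), clippedMin (fun i => value g B j i (Y ω)) T := by
    have := Finset.card_nsmul_le_sum (Finset.range (k + 1))
      (fun j => clippedMin (fun i => value g B j i (Y ω)) T) _
      fun j hj => hanti (Nat.lt_succ_iff.1 (Finset.mem_range.1 hj))
    simpa using this
  rw [le_div_iff₀ (by positivity)]
  push_cast at h6
  linarith

/-- At time 0 the payout is the default value 0 and the simulator draws from the unconditional law
of Y. -/
theorem value_zero (hg : ∀ i, Measurable (g i)) (hB : IsBaseSimulator P Y B)
    (k : ℕ) (y : SamplePath T D) : value g B k 0 y =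
      -∑ j ∈ Finset.range k, ∫ ω, clippedMin (fun i => value g B j i (Y ω)) T ∂P := by
  induction k with
  | zero => simp [value, evalPayout]
  | succ k ih =>
    have h1 := setIntegral_simulate hB 0
      (measurable_clippedMin (measurable_value hg B k) T)
      (fun z => clippedMin_mem (fun i => value g B k i z) T) MeasurableSet.univ
    have h2 : ∀ ω, simulate B 0 (Y ω) = simulate B 0 y := fun ω =>
      simulate_congr B (past_eq_of_forall fun j hj => absurd hj (Nat.not_lt_zero _))
    simp only [h2, Set.preimage_univ, Measure.restrict_univ, integral_const] at h1
    rw [value, ih, Finset.sum_range_succ, ← h1]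
    simp
    ring

end AlongProcess

/-! ### The optimal value -/

theorem integral_stopped {T : ℕ} {Ω : Type*} [MeasurableSpace Ω] {P : Measure Ω}
    {f : Fin T → Ω → ℝ} {τ : Ω → Fin T}
    (hτ : ∀ i, MeasurableSet {ω | τ ω = i}) (hf : ∀ i, Integrable (f i) P) :
    Integrable (fun ω => f (τ ω) ω) P ∧
      ∫ ω, f (τ ω) ω ∂P = ∑ i, ∫ ω in {ω | τ ω = i}, f i ω ∂P := by
  have h1 : (fun ω => f (τ ω) ω) = fun ω => ∑ i, {ω | τ ω = i}.indicator (f i) ω := by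
    ext ω
    rw [Finset.sum_eq_single (τ ω)]
    · simp
    · intro i _ hi
      simp [hi.symm]
    · simp
  have h2 : ∀ i, Integrable ({ω | τ ω = i}.indicator (f i)) P := fun i => (hf i).indicator (hτ i)
  rw [h1]
  refine ⟨integrable_finsetSum _ fun i _ => h2 i, ?_⟩
  rw [integral_finsetSum _ fun i _ => h2 i]
  exact Finset.sum_congr rfl fun i _ => integral_indicator (hτ i)

/-- Setting future columns to zero leaves the value unchanged. The σ-algebra on Ω is arbitrary so
that it can be taken from the filtration. -/
theorem measurable_value_of_past {T D : ℕ} {Ω : Type*} [MeasurableSpace Ω]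
    {Y : Ω → SamplePath T D} {g : Payouts T D} {B : Simulator T D} [∀ t, IsMarkovKernel (B t)]
    (hg : ∀ i, Measurable (g i)) (k : ℕ) {i : Fin T} (hY : ∀ j ≤ i, Measurable fun ω => Y ω j) :
    Measurable fun ω => value g B k (i + 1) (Y ω) := by
  let cut : SamplePath T D → SamplePath T D := fun y j => if j ≤ i then y j else 0
  have h1 : ∀ ω, value g B k (i + 1) (Y ω) = value g B k (i + 1) (cut (Y ω)) := fun ω =>
    value_congr g B k (past_eq_of_forall fun j hj =>
      (if_pos (Nat.le_of_lt_succ hj : j ≤ i)).symm)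
  simp only [h1]
  refine (measurable_value hg B k _).comp (measurable_pi_iff.2 fun j => ?_)
  by_cases hj : j ≤ i
  · simpa [cut, hj] using hY j hj
  · simp [cut, hj]

section Optimal

variable {T D : ℕ} {Ω : Type*} [MeasurableSpace Ω] {P : Measure Ω} [IsProbabilityMeasure P]
  {Y : Ω → SamplePath T D} {g : Payouts T D} {B : Simulator T D} [∀ t, IsMarkovKernel (B t)]

theorem pathFiltration_le_comap (hY : Measurable Y) (i : Fin T) :
    pathFiltration Y hY i ≤
      MeasurableSpace.comap (fun ω => past (i + 1) (Y ω)) MeasurableSpace.pi := by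
  refine iSup₂_le fun j hj => ?_
  rintro s ⟨t, ht, rfl⟩
  have hj' : j.1 < min (i.1 + 1) T := lt_min (Nat.lt_succ_of_le hj) j.2
  exact ⟨(fun x : Hist D (min (i.1 + 1) T) => x ⟨j, hj'⟩) ⁻¹' t, measurable_pi_apply _ ht, rfl⟩

theorem measurable_coord_pathFiltration (hY : Measurable Y) {i j : Fin T} (hj : j ≤ i) :
    Measurable[pathFiltration Y hY i] fun ω => Y ω j := by
  refine Measurable.mono (comap_measurable _) ?_ le_rfl
  exact le_iSup₂_of_le (f := fun j (_ : j ≤ i) => MeasurableSpace.comap (fun ω => Y ω j) _)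
    j hj le_rfl

theorem integrable_value (hg : ∀ i, Measurable (g i)) (hY : Measurable Y)
    (hB : IsBaseSimulator P Y B) (h01 : ∀ᵐ ω ∂P, ∀ i, payout g i (Y ω) ∈ Set.Icc (0 : ℝ) 1)
    (k : ℕ) (i : Fin T) : Integrable (fun ω => value g B k (i + 1) (Y ω)) P := by
  refine Integrable.of_mem_Icc 0 1 ((measurable_value hg B k _).comp hY).aemeasurable ?_
  filter_upwards [h01, ae_value_nonneg hg hB h01 k] with ω h1 h2
  have hanti : Antitone fun k => value g B k (i + 1) (Y ω) :=
    antitone_nat_of_succ_le fun k => value_succ_le g B k _ _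
  have hi : 0 < i.1 + 1 ∧ i.1 + 1 ≤ T := ⟨by omega, i.2⟩
  have h0 : value g B 0 (i + 1) (Y ω) ≤ 1 := by simpa [value, evalPayout, hi] using (h1 i).2
  exact ⟨h2 i, (hanti (Nat.zero_le k)).trans h0⟩

theorem measurableSet_stopping_eq (hY : Measurable Y) {τ : Ω → Fin T}
    (hτ : IsStoppingTime (pathFiltration Y hY) fun ω => (τ ω : WithTop (Fin T))) (i : Fin T) :
    MeasurableSet[pathFiltration Y hY i] {ω | τ ω = i} := by
  have h := hτ.measurableSet_eq_of_countable i
  simpa using h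

/-- Passing to the value functions subtracts a martingale from the payouts. -/
theorem integral_stopped_value (hg : ∀ i, Measurable (g i)) (hY : Measurable Y)
    (hB : IsBaseSimulator P Y B) (h01 : ∀ᵐ ω ∂P, ∀ i, payout g i (Y ω) ∈ Set.Icc (0 : ℝ) 1)
    {τ : Ω → Fin T} (hτ : IsStoppingTime (pathFiltration Y hY) fun ω => (τ ω : WithTop (Fin T)))
    (k : ℕ) (y : SamplePath T D) :
    ∫ ω, value g B k (τ ω + 1) (Y ω) ∂P = ∫ ω, payout g (τ ω) (Y ω) ∂P + value g B k 0 y := by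
  have hτF := measurableSet_stopping_eq hY hτ
  have hτm : ∀ i, MeasurableSet {ω | τ ω = i} := fun i => (pathFiltration Y hY).le i _ (hτF i)
  rw [value_zero hg hB]
  induction k with
  | zero =>
    have h : ∀ ω, value g B 0 (τ ω + 1) (Y ω) = payout g (τ ω) (Y ω) := fun ω => by
      have hi : 0 < (τ ω).1 + 1 ∧ (τ ω).1 + 1 ≤ T := ⟨by omega, (τ ω).2⟩
      simp [value, evalPayout, hi]
    simp [h]
  | succ k ih =>
    set h : SamplePath T D → ℝ := fun z => clippedMin (fun i => value g B k i z) T with hh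
    have hmeas : Measurable h := measurable_clippedMin (measurable_value hg B k) T
    have hmem : ∀ z, h z ∈ Set.Icc (0 : ℝ) 1 := fun z => clippedMin_mem _ T
    have hint := integrable_value hg hY hB h01 k
    have hint' : ∀ i : Fin T, Integrable (fun ω => ∫ z, h z ∂simulate B (i + 1) (Y ω)) P := by
      intro i
      have := (hint i).sub (integrable_value hg hY hB h01 (k + 1) i)
      refine this.congr (ae_of_all _ fun ω => ?_)
      simp only [Pi.sub_apply, value]
      rw [sub_sub_cancel]
    have h1 := integral_stopped hτm hint'
    have hhY : Integrable (fun ω => h (Y ω)) P :=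
      Integrable.of_mem_Icc 0 1 (hmeas.comp hY).aemeasurable (ae_of_all _ fun ω => hmem _)
    have h2 := integral_stopped (f := fun _ ω => h (Y ω)) hτm fun _ => hhY
    have h3 := integral_stopped hτm hint
    -- Optional stopping by hand: each event `τ = i` belongs to the past at time i + 1, where the
    -- conditional expectation integrates like the minimum itself.
    have h4 : ∫ ω, ∫ z, h z ∂simulate B (τ ω + 1) (Y ω) ∂P = ∫ ω, h (Y ω) ∂P := by
      rw [h1.2, h2.2]
      refine Finset.sum_congr rfl fun i _ => ?_
      obtain ⟨s, hs, hs'⟩ := pathFiltration_le_comap hY i _ (hτF i)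
      rw [← hs']
      exact setIntegral_simulate hB (i + 1) hmeas hmem hs
    simp only [value]
    rw [integral_sub h3.1 h1.1, ih, Finset.sum_range_succ, h4]
    ring

/-- Below: level-k values are nonnegative at every stopping time. Above: the first time at which
they drop to 1/(k+1) is a stopping time, and almost surely they do drop. -/
theorem optValue_bounds (hT : 1 ≤ T) (hg : ∀ i, Measurable (g i)) (hY : Measurable Y)
    (hB : IsBaseSimulator P Y B) (h01 : ∀ᵐ ω ∂P, ∀ i, payout g i (Y ω) ∈ Set.Icc (0 : ℝ) 1)
    {k : ℕ} (hk : 1 ≤ k) (y : SamplePath T D) :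
    -value g B k 0 y ≤ optValue P Y hY g ∧
      optValue P Y hY g ≤ -value g B k 0 y + 1 / (k + 1) := by
  have hnonneg : ∀ τ : Ω → Fin T, 0 ≤ ∫ ω, value g B k (τ ω + 1) (Y ω) ∂P := fun τ =>
    integral_nonneg_of_ae ((ae_value_nonneg hg hB h01 k).mono fun ω hω => hω _)
  let last : Fin T := ⟨T - 1, by omega⟩
  constructor
  · have : Nonempty {τ : Ω → Fin T // IsStoppingTime (pathFiltration Y hY)
        fun ω => (τ ω : WithTop (Fin T))} :=
      ⟨⟨fun _ => last, isStoppingTime_const _ last⟩⟩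
    refine le_ciInf fun τ => ?_
    have h := integral_stopped_value hg hY hB h01 τ.2 k y
    linarith [hnonneg τ.1]
  · classical
    set c : ℝ := 1 / (k + 1) with hc
    have hlast : ∀ j : Fin T, j ≤ last := fun j => Nat.le_sub_one_of_lt j.2
    -- The last time is always admitted, so that τ is defined everywhere.
    let candidates : Ω → Finset (Fin T) := fun ω =>
      {j | j = last ∨ value g B k (j + 1) (Y ω) ≤ c}
    have hne : ∀ ω, (candidates ω).Nonempty := fun ω => ⟨last, by simp [candidates]⟩
    let τ : Ω → Fin T := fun ω => (candidates ω).min' (hne ω)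
    have hτ : IsStoppingTime (pathFiltration Y hY) fun ω => (τ ω : WithTop (Fin T)) := by
      intro i
      have h1 : {ω | (τ ω : WithTop (Fin T)) ≤ i} = ⋃ j : Fin T, ⋃ _ : j ≤ i,
          ({ω | j = last} ∪ {ω | value g B k (j + 1) (Y ω) ≤ c}) := by
        ext ω
        simp only [WithTop.coe_le_coe, Set.mem_ofPred_eq, Set.mem_iUnion, Set.mem_union,
          exists_prop]
        constructor
        · intro h
          exact ⟨τ ω, h, by simpa [candidates] using (candidates ω).min'_mem (hne ω)⟩
        · rintro ⟨j, hj, hj'⟩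
          exact ((candidates ω).min'_le j (by simpa [candidates] using hj')).trans hj
      rw [h1]
      refine MeasurableSet.iUnion fun j => MeasurableSet.iUnion fun hj => ?_
      refine MeasurableSet.union (MeasurableSet.const _) ?_
      exact (pathFiltration Y hY).mono hj _
        (@measurable_value_of_past T D Ω (pathFiltration Y hY j) Y g B _ hg k j
          (fun l hl => measurable_coord_pathFiltration hY hl) _ measurableSet_Iic)
    have hτle : ∀ᵐ ω ∂P, value g B k (τ ω + 1) (Y ω) ≤ c := by
      filter_upwards [ae_clippedMin_le hT hg hB h01 k] with ω hω
      -- Needed since `clippedMin` starts from 1: only a bound below 1 must be attained by some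
      -- value.
      have hc1 : c < 1 := by
        have : (1 : ℝ) ≤ k := by exact_mod_cast hk
        rw [hc, div_lt_one (by positivity)]
        linarith
      obtain ⟨n, hn1, hnT, hn⟩ := exists_le_of_clippedMin_le hc1 hω
      have hmem := (candidates ω).min'_mem (hne ω)
      have hle : τ ω ≤ ⟨n - 1, by omega⟩ := (candidates ω).min'_le _ (by
        have : n - 1 + 1 = n := by omega
        simp [candidates, this, hn])
      rcases (by simpa [candidates] using hmem :
        τ ω = last ∨ value g B k (τ ω + 1) (Y ω) ≤ c) with h | h
      · have h2 : τ ω = ⟨n - 1, by omega⟩ := le_antisymm hle (h ▸ hlast _)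
        have : n - 1 + 1 = n := by omega
        simpa [h2, this] using hn
      · exact h
    have hτm : ∀ i, MeasurableSet {ω | τ ω = i} := fun i =>
      (pathFiltration Y hY).le i _ (measurableSet_stopping_eq hY hτ i)
    have h1 := integral_mono_ae (integral_stopped hτm (integrable_value hg hY hB h01 k)).1
      (integrable_const c) hτle
    rw [integral_stopped_value hg hY hB h01 hτ k y] at h1
    simp only [integral_const, probReal_univ, one_smul] at h1
    have hbdd : BddBelow (Set.range fun τ : {τ : Ω → Fin T // IsStoppingTime
        (pathFiltration Y hY) fun ω => (τ ω : WithTop (Fin T))} =>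
        ∫ ω, payout g (τ.1 ω) (Y ω) ∂P) := by
      refine ⟨0, ?_⟩
      rintro _ ⟨σ, rfl⟩
      exact integral_nonneg_of_ae (h01.mono fun ω hω => (hω _).1)
    have h2 : optValue P Y hY g ≤ ∫ ω, payout g (τ ω) (Y ω) ∂P := ciInf_le hbdd ⟨τ, hτ⟩
    linarith

end Optimal

/-! ### Parameters -/

section Parameters

/-- There is a least `K` with `2 ≤ ε * K`; it is at most `3 / ε`. -/
theorem exists_levels {ε : ℝ} (hε : ε ∈ Set.Ioo (0 : ℝ) 1) :
    ∃ K : ℕ, 2 ≤ ε * K ∧ (∀ i < K, ε * i < 2) ∧ 3 ≤ K ∧ (K : ℝ) ≤ 3 / ε := by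
  classical
  have hex : ∃ K : ℕ, 2 ≤ ε * K := by
    obtain ⟨K, hK⟩ := exists_nat_ge (2 / ε)
    exact ⟨K, by rwa [div_le_iff₀' hε.1] at hK⟩
  have h1 := Nat.find_spec hex
  have h2 : ∀ i < Nat.find hex, ε * i < 2 := fun i hi => not_le.1 (Nat.find_min hex hi)
  set K := Nat.find hex
  have h3 : 3 ≤ K := by
    by_contra h
    have : (K : ℝ) ≤ 2 := by exact_mod_cast (by omega : K ≤ 2)
    nlinarith [hε.1, hε.2]
  refine ⟨K, h1, h2, h3, ?_⟩
  rw [le_div_iff₀ hε.1]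
  -- Minimality gives ε(K - 1) < 2, hence εK < 2 + ε < 3.
  have h4 := h2 (K - 1) (by omega)
  rw [Nat.cast_sub (by omega)] at h4
  push_cast at h4
  nlinarith [hε.2]

/-- There is a least number of doublings that take `δ` above one; it is logarithmic in `1 / δ`. -/
theorem exists_doublings {δ : ℝ} (hδ : δ ∈ Set.Ioo (0 : ℝ) 1) :
    ∃ m : ℕ, 1 ≤ δ * 2 ^ m ∧ (∀ i < m, δ * 2 ^ i < 1) ∧
      (m + 1 : ℝ) ≤ 2 * (1 + Real.log (1 / δ)) := by
  classical
  have hex : ∃ m : ℕ, 1 ≤ δ * 2 ^ m := by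
    obtain ⟨m, hm⟩ := pow_unbounded_of_one_lt (1 / δ) one_lt_two
    exact ⟨m, by rw [div_lt_iff₀' hδ.1] at hm; exact hm.le⟩
  have h1 := Nat.find_spec hex
  have h2 : ∀ i < Nat.find hex, δ * 2 ^ i < 1 := fun i hi => not_le.1 (Nat.find_min hex hi)
  set m := Nat.find hex
  refine ⟨m, h1, h2, ?_⟩
  have hm : m ≠ 0 := by
    intro h
    rw [h, pow_zero, mul_one] at h1
    exact h1.not_gt hδ.2
  obtain ⟨n, hn⟩ := Nat.exists_eq_succ_of_ne_zero hm
  have h3 := h2 n (by omega)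
  have h4 : (2 : ℝ) ^ n ≤ 1 / δ := by
    rw [le_div_iff₀' hδ.1]
    exact h3.le
  have h5 := Real.log_le_log (by positivity) h4
  rw [Real.log_pow] at h5
  -- Only log 2 > 1/2 matters.
  have h6 := Real.log_two_gt_d9
  have h7 : (m : ℝ) = n + 1 := by rw [hn]; push_cast; ring
  rw [h7]
  nlinarith [(Nat.cast_nonneg n : (0 : ℝ) ≤ n)]

/-! ### Choice of accuracy and sample size -/

theorem two_mul_le_four_pow (K : ℕ) (hK : 1 ≤ K) : 2 * K ≤ 4 ^ K := by
  have h1 : K < 2 ^ K := Nat.lt_two_pow_self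
  have h2 : 2 ^ 1 ≤ 2 ^ K := Nat.pow_le_pow_right (by norm_num) hK
  calc 2 * K ≤ 2 ^ K * 2 ^ K := Nat.mul_le_mul (by simpa using h2) h1.le
    _ = 4 ^ K := by rw [← mul_pow]; rfl

/-- With a = 4^K/2 the Hoeffding exponent is (m+1)Ta, at least (a-2) + (m+1) + T. These three parts
dominate the factors 8aK, 1/δ and T of 2/q respectively. -/
theorem two_mul_exp_le {T K m : ℕ} (hT : 1 ≤ T) (hK : 3 ≤ K) {δ : ℝ} (hδ : 0 < δ)
    (hm : 1 ≤ δ * 2 ^ m) :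
    2 * Real.exp (-(2 * ((m + 1) * (64 ^ K * T) : ℕ) * (1 / (2 * 4 ^ K)) ^ 2)) ≤
      δ / (2 * 4 ^ K * T * K) := by
  set a : ℝ := 4 ^ K / 2 with ha
  have hT' : (1 : ℝ) ≤ T := by exact_mod_cast hT
  have hK' : (3 : ℝ) ≤ K := by exact_mod_cast hK
  have hm' : (0 : ℝ) ≤ m := Nat.cast_nonneg m
  have hKa : (K : ℝ) ≤ a := by
    have : (2 * K : ℝ) ≤ 4 ^ K := by exact_mod_cast two_mul_le_four_pow K (by omega)
    rw [ha]
    linarith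
  have ha32 : 32 ≤ a := by
    have : (4 : ℝ) ^ 3 ≤ 4 ^ K := pow_le_pow_right₀ (by norm_num) hK
    rw [ha]
    linarith
  have hexponent : 2 * (((m + 1) * (64 ^ K * T) : ℕ) : ℝ) * (1 / (2 * 4 ^ K)) ^ 2 =
      (m + 1) * T * a := by
    have h64 : (64 : ℝ) ^ K = 4 ^ K * 4 ^ K * 4 ^ K := by rw [← mul_pow, ← mul_pow]; norm_num
    push_cast
    rw [ha, h64]
    field_simp
  rw [hexponent, Real.exp_neg]
  have hsum : (a - 2) + (m + 1) + T ≤ (m + 1) * T * a := by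
    have h1 : (1 : ℝ) ≤ (m + 1) * T := by nlinarith
    nlinarith
  have h1 : 8 * a * K ≤ Real.exp (a - 2) := by
    -- The fourth Taylor term suffices, because a ≥ 32 and 8aK ≤ 8a².
    have h := Real.pow_div_factorial_le_exp (a - 2) (by linarith) 4
    refine le_trans ?_ h
    have h2 : 15 / 16 * a ≤ a - 2 := by linarith
    have h3 : (15 / 16 * a) ^ 4 ≤ (a - 2) ^ 4 := by gcongr
    have h4 : 8 * a * K ≤ 8 * a * a := by gcongr
    have h5 : 32 * 32 * (a * a) ≤ a * a * (a * a) := by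
      gcongr ?_ * _
      nlinarith
    rw [le_div_iff₀ (by positivity)]
    simp only [Nat.factorial]
    push_cast
    nlinarith
  have h2 : 1 / δ ≤ Real.exp (m + 1) := by
    rw [div_le_iff₀' hδ]
    refine hm.trans (mul_le_mul_of_nonneg_left ?_ hδ.le)
    have h3 : (2 : ℝ) ≤ Real.exp 1 := by linarith [Real.add_one_le_exp 1]
    calc (2 : ℝ) ^ m ≤ Real.exp 1 ^ m := by gcongr
      _ = Real.exp m := by rw [← Real.exp_nat_mul, mul_one]
      _ ≤ Real.exp (m + 1) := Real.exp_le_exp.2 (by linarith)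
  have h3 : (T : ℝ) ≤ Real.exp T := by linarith [Real.add_one_le_exp (T : ℝ)]
  have h4 : 8 * a * K * (1 / δ) * T ≤ Real.exp ((m + 1) * T * a) := by
    calc 8 * a * K * (1 / δ) * T ≤ Real.exp (a - 2) * Real.exp (m + 1) * Real.exp T := by gcongr
      _ = Real.exp ((a - 2) + (m + 1) + T) := by rw [← Real.exp_add, ← Real.exp_add]
      _ ≤ _ := Real.exp_le_exp.2 hsum
  rw [← div_eq_mul_inv, div_le_div_iff₀ (Real.exp_pos _) (by positivity)]
  have h5 : 2 * (2 * 4 ^ K * T * K) = 8 * a * K * (1 / δ) * T * δ := by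
    rw [ha]
    field_simp
    norm_num
  rw [h5, mul_comm δ]
  gcongr

/-- Bias and sampling error are each at most 1/(2·4^K) per level, so amplification by 2^K leaves at
most 2^{-K} ≤ 1/K. Truncation costs at most another 1/K, and 2/K ≤ ε. -/
theorem accuracy_le {T K : ℕ} (hT : 1 ≤ T) (hK : 3 ≤ K) {δ ε : ℝ} (hδ : δ ∈ Set.Ioo (0 : ℝ) 1)
    (hε : 2 ≤ ε * K) :
    (2 ^ K - 1) * (T * (K * (δ / (2 * 4 ^ K * T * K))) + 1 / (2 * 4 ^ K)) + 1 / (K + 1) ≤ ε := by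
  have hT' : (0 : ℝ) < T := by exact_mod_cast hT
  have hK' : (0 : ℝ) < K := by exact_mod_cast (by omega : 0 < K)
  have h1 : (T : ℝ) * (K * (δ / (2 * 4 ^ K * T * K))) = δ * (1 / (2 * 4 ^ K)) := by field_simp
  have h2 : δ * (1 / (2 * 4 ^ K : ℝ)) ≤ 1 * (1 / (2 * 4 ^ K)) :=
    mul_le_mul_of_nonneg_right hδ.2.le (by positivity)
  have h3 : (2 ^ K - 1 : ℝ) * (T * (K * (δ / (2 * 4 ^ K * T * K))) + 1 / (2 * 4 ^ K)) ≤
      2 ^ K * (1 / 4 ^ K) := by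
    have h0 := hδ.1
    refine mul_le_mul (by linarith) ?_ (by positivity) (by positivity)
    rw [h1]
    have : (1 : ℝ) / 4 ^ K = 1 / (2 * 4 ^ K) + 1 / (2 * 4 ^ K) := by field_simp; norm_num
    linarith
  have h4 : (2 : ℝ) ^ K * (1 / 4 ^ K) = 1 / 2 ^ K := by
    rw [show (4 : ℝ) = 2 * 2 by norm_num, mul_pow]
    field_simp
  have h5 : (1 : ℝ) / 2 ^ K ≤ 1 / K := by
    apply one_div_le_one_div_of_le hK'
    exact_mod_cast (Nat.lt_two_pow_self (n := K)).le
  have h6 : (1 : ℝ) / (K + 1) ≤ 1 / K := one_div_le_one_div_of_le hK' (by linarith)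
  have h7 : 1 / (K : ℝ) + 1 / K ≤ ε := by
    rw [← add_div, div_le_iff₀ hK']
    linarith
  linarith

/-! ### Bounds on the total cost -/

/-- The shift by 5 absorbs the additive overhead, leaving geometric growth with ratio 4NT. -/
theorem estCost_le {T N : ℕ} (hT : 1 ≤ T) (hN : 1 ≤ N) (k : ℕ) :
    estCost T N k + 5 ≤ 7 * (4 * (N * T)) ^ k := by
  induction k with
  | zero => simp [estCost]
  | succ k ih =>
    have hNT : 1 ≤ N * T := Nat.mul_pos hN hT
    have hNT' : N ≤ N * T := Nat.le_mul_of_pos_right N hT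
    have h7 : 7 ≤ estCost T N k + 5 := by
      cases k with
      | zero => exact le_rfl
      | succ k => nlinarith [estCost.eq_2 T N k, Nat.zero_le (estCost T N k),
          Nat.mul_le_mul hN (Nat.le_add_right 5 (T * (estCost T N k + 4)))]
    rw [estCost, pow_succ]
    calc estCost T N k + 5 + N * (5 + T * (estCost T N k + 4)) + 5
        ≤ N * T * (estCost T N k + 10) + (N * T * 5 + N * T * (estCost T N k + 4)) := by
          nlinarith
      _ = N * T * (2 * estCost T N k + 19) := by ring
      _ ≤ N * T * (4 * (estCost T N k + 5)) := Nat.mul_le_mul_left _ (by omega)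
      _ ≤ N * T * (4 * (7 * (4 * (N * T)) ^ k)) := by gcongr
      _ = 7 * ((4 * (N * T)) ^ k * (4 * (N * T))) := by ring

theorem totalCost_le {T K m : ℕ} (hT : 1 ≤ T) (hK : 1 ≤ K) :
    4 * K + 3 * m + 5 + estCost T ((m + 1) * (64 ^ K * T)) K ≤
      (64 * ((m + 1) * (64 ^ K * T) * T)) ^ K := by
  set N := (m + 1) * (64 ^ K * T) with hN
  have h64 : K < 64 ^ K := Nat.lt_pow_self (by norm_num)
  have h1 : m + 1 ≤ N := Nat.le_mul_of_pos_right _ (by positivity)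
  have h2 : 64 ^ K ≤ N := by
    calc 64 ^ K = 1 * (64 ^ K * 1) := by ring
      _ ≤ (m + 1) * (64 ^ K * T) := Nat.mul_le_mul (by omega) (Nat.mul_le_mul_left _ hT)
  have h3 : N ≤ N * T := Nat.le_mul_of_pos_right _ hT
  have h4 : 4 * (N * T) ≤ (4 * (N * T)) ^ K := Nat.le_self_pow (by omega) _
  have h5 := estCost_le hT (by omega : 1 ≤ N) K
  have h6 : 16 ^ 1 ≤ 16 ^ K := Nat.pow_le_pow_right (by norm_num) hK
  calc 4 * K + 3 * m + 5 + estCost T N K ≤ 16 * (4 * (N * T)) ^ K := by omega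
    _ ≤ 16 ^ K * (4 * (N * T)) ^ K := Nat.mul_le_mul_right _ (by simpa using h6)
    _ = (64 * (N * T)) ^ K := by
      rw [← mul_pow]
      congr 1
      ring

/-- The base is at most 2^{9K} T² L with L = 1 + log(1/δ). Raised to the power K ≤ 3/ε it yields
exponents 9K² ≤ 81/ε², 2K ≤ 6/ε and K ≤ 6/ε. -/
theorem totalCost_le_callBound {T K m : ℕ} (hT : 1 ≤ T) (hK : 3 ≤ K) {ε δ : ℝ}
    (hε : ε ∈ Set.Ioo (0 : ℝ) 1) (hKε : (K : ℝ) ≤ 3 / ε) (hδ : δ ∈ Set.Ioo (0 : ℝ) 1)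
    (hm : (m + 1 : ℝ) ≤ 2 * (1 + Real.log (1 / δ))) :
    (((64 * ((m + 1) * (64 ^ K * T) * T)) ^ K : ℕ) : ℝ) ≤ callBound T ε δ := by
  set L : ℝ := 1 + Real.log (1 / δ) with hL
  have hT' : (1 : ℝ) ≤ T := by exact_mod_cast hT
  have hL1 : 1 ≤ L := by
    have : 0 ≤ Real.log (1 / δ) := Real.log_nonneg (by rw [le_div_iff₀ hδ.1]; linarith [hδ.2])
    linarith
  have hε0 := hε.1
  have h1 : (((64 * ((m + 1) * (64 ^ K * T) * T)) ^ K : ℕ) : ℝ) ≤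
      (2 ^ (9 * K)) ^ K * (T : ℝ) ^ (2 * K) * L ^ K := by
    rw [pow_mul (T : ℝ), ← mul_pow, ← mul_pow]
    push_cast
    gcongr ?_ ^ K
    have h2 : (128 : ℝ) * 64 ^ K ≤ 2 ^ (9 * K) := by
      calc (128 : ℝ) * 64 ^ K = 2 ^ (7 + 6 * K) := by rw [pow_add, pow_mul]; norm_num
        _ ≤ 2 ^ (9 * K) := pow_le_pow_right₀ (by norm_num) (by omega)
    calc (64 : ℝ) * ((m + 1) * (64 ^ K * T) * T) ≤ 64 * (2 * L * (64 ^ K * T) * T) := by gcongr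
      _ = 128 * 64 ^ K * T ^ 2 * L := by ring
      _ ≤ 2 ^ (9 * K) * T ^ 2 * L := by gcongr
  refine h1.trans ?_
  unfold callBound
  have hexp : ((2 : ℝ) ^ (9 * K)) ^ K ≤ Real.exp (200 * (ε ^ 2)⁻¹) := by
    have h3 : (2 : ℝ) ≤ Real.exp 1 := by linarith [Real.add_one_le_exp 1]
    calc ((2 : ℝ) ^ (9 * K)) ^ K ≤ (Real.exp 1 ^ (9 * K)) ^ K := by gcongr
      _ = Real.exp (9 * K * K) := by
        rw [← pow_mul, ← Real.exp_nat_mul]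
        push_cast
        ring_nf
      _ ≤ Real.exp (200 * (ε ^ 2)⁻¹) := by
        refine Real.exp_le_exp.2 ?_
        have h4 : (K : ℝ) * K ≤ 3 / ε * (3 / ε) := by gcongr
        have h5 : 3 / ε * (3 / ε) = 9 * (ε ^ 2)⁻¹ := by field_simp; norm_num
        have h6 : 0 ≤ (ε ^ 2)⁻¹ := by positivity
        nlinarith
  have hTpow : (T : ℝ) ^ (2 * K) ≤ (T : ℝ) ^ (6 / ε) := by
    rw [← Real.rpow_natCast]
    refine Real.rpow_le_rpow_of_exponent_le hT' ?_
    push_cast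
    calc 2 * (K : ℝ) ≤ 2 * (3 / ε) := by gcongr
      _ = 6 / ε := by ring
  have hLpow : L ^ K ≤ L ^ (6 / ε) := by
    rw [← Real.rpow_natCast]
    refine Real.rpow_le_rpow_of_exponent_le hL1 (hKε.trans ?_)
    gcongr
    norm_num
  gcongr

end Parameters

end OptStop

theorem corollary2 :
    ∃ A : OptStop.Program,
      ∀ (T D : ℕ), 1 ≤ T →
      ∀ (Ω : Type*) [MeasurableSpace Ω] (P : Measure Ω) [IsProbabilityMeasure P]
        (Y : Ω → OptStop.SamplePath T D) (hY : Measurable Y)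
        (g : OptStop.Payouts T D), (∀ i, Measurable (g i)) →
        (∀ᵐ ω ∂P, ∀ i, OptStop.payout g i (Y ω) ∈ Set.Icc (0 : ℝ) 1) →
      ∀ (B : OptStop.Simulator T D), (∀ t, IsMarkovKernel (B t)) →
        OptStop.IsBaseSimulator P Y B →
      ∀ C G : ℝ, 1 ≤ C → 1 ≤ G →
      ∀ ε ∈ Set.Ioo (0 : ℝ) 1, ∀ δ ∈ Set.Ioo (0 : ℝ) 1,
        ∃ depth : ℕ,
          IsProbabilityMeasure (OptStop.runOn A g B ε δ depth) ∧
          (∀ᵐ o ∂(OptStop.runOn A g B ε δ depth),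
            o.2.time C G ≤ (C + G + 1) * OptStop.callBound T ε δ ∧
            (o.2.calls : ℝ) ≤ OptStop.callBound T ε δ) ∧
          ENNReal.ofReal (1 - δ) ≤
            OptStop.runOn A g B ε δ depth
              {o | |o.1 - OptStop.optValue P Y hY g| ≤ ε} := by
  refine ⟨OptStop.algorithm, ?_⟩
  intro T D hT Ω _ P _ Y hY g hg h01 B hBm hB C G hC hG ε hε δ hδ
  obtain ⟨K, hK, hK', hK3, hKε⟩ := OptStop.exists_levels hε
  obtain ⟨m, hm, hm', hmδ⟩ := OptStop.exists_doublings hδ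
  obtain ⟨c, hc, d, hd⟩ := OptStop.runOn_algorithm hg B hm hm' hK hK'
  have hsize : (c.size : ℝ) ≤ OptStop.callBound T ε δ :=
    (Nat.cast_le.2 (hc.trans (OptStop.totalCost_le hT (by omega)))).trans
      (OptStop.totalCost_le_callBound hT hK3 hε hKε hδ hmδ)
  set N := (m + 1) * (64 ^ K * T) with hN
  have hNpos : 0 < N := by positivity
  have hprob := (OptStop.estLaw_spec hg B N K).1 0 0
  have hmap : Measurable fun x : ℝ => (0 - x, c) := by fun_prop
  refine ⟨d, ?_, ?_, ?_⟩
  · rw [hd]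
    exact Measure.isProbabilityMeasure_map hmap.aemeasurable
  · rw [hd]
    refine (ae_map_iff hmap.aemeasurable (measurable_snd (MeasurableSpace.measurableSet_top
      (s := {u : OptStop.Usage | u.time C G ≤ (C + G + 1) * OptStop.callBound T ε δ ∧
        (u.calls : ℝ) ≤ OptStop.callBound T ε δ})))).2 ?_
    refine ae_of_all _ fun x => ⟨?_, ?_⟩
    · refine (OptStop.Usage.time_le (by linarith) (by linarith) c).trans ?_
      gcongr
    · refine le_trans ?_ hsize
      exact_mod_cast (by unfold OptStop.Usage.size; omega : c.calls ≤ c.size)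
  -- Sampling error s and failure probability q per level, with Kq ≤ δ; s matches N so that the
  -- Hoeffding bound is at most q.
  · set s : ℝ := 1 / (2 * 4 ^ K) with hs
    set q : ℝ := δ / (2 * 4 ^ K * T * K) with hq
    have hδ0 := hδ.1
    have hacc := OptStop.estLaw_accuracy hg B hNpos (s := s) (q := q) (by positivity)
      (OptStop.two_mul_exp_le hT hK3 hδ0 hm) K le_rfl 0 0
    have hval := OptStop.optValue_bounds hT hg hY hB h01 (k := K) (by omega) 0
    have he := OptStop.accuracy_le hT hK3 hδ hK
    have hKq : K * q ≤ δ := by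
      have hT' : (1 : ℝ) ≤ T := by exact_mod_cast hT
      have hK0 : (0 : ℝ) < K := by exact_mod_cast (by omega : 0 < K)
      have h4 : (1 : ℝ) ≤ 4 ^ K := one_le_pow₀ (by norm_num)
      have h1 : K * q = δ / (2 * 4 ^ K * T) := by rw [hq]; field_simp
      rw [h1]
      exact div_le_self hδ0.le (by nlinarith)
    set e : ℝ := (2 ^ K - 1) * (T * (K * q) + s) with hedef
    set bad : Set ℝ := {x | e < |x - OptStop.value g B K 0 0|} with hbad
    have hbadm : MeasurableSet bad := OptStop.measurableSet_lt_abs_sub _ _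
    have hgood : MeasurableSet {o : OptStop.Outcome | |o.1 - OptStop.optValue P Y hY g| ≤ ε} :=
      measurableSet_le (by fun_prop) measurable_const
    rw [hd, Measure.map_apply hmap hgood]
    -- Outside the bad event the error is estimation error plus truncation error 1/(K+1), together
    -- at most ε.
    have hsub : badᶜ ⊆ (fun x : ℝ => (0 - x, c)) ⁻¹'
        {o : OptStop.Outcome | |o.1 - OptStop.optValue P Y hY g| ≤ ε} := by
      intro x hx
      have hx' : |x - OptStop.value g B K 0 0| ≤ e := not_lt.1 hx
      change |0 - x - OptStop.optValue P Y hY g| ≤ ε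
      rw [abs_le] at hx' ⊢
      constructor <;> linarith [hx'.1, hx'.2, hval.1, hval.2]
    refine le_trans ?_ (measure_mono hsub)
    rw [prob_compl_eq_one_sub hbadm, ENNReal.ofReal_sub _ hδ0.le, ENNReal.ofReal_one]
    exact tsub_le_tsub_left (hacc.trans (ENNReal.ofReal_le_ofReal hKq)) 1
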